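/- Let $T\ge 2$ and suppose we are given a fast matrix multiplication algorithm that multiplies two $T\times T$ matrices with $r>T^2$ multiplications: products $M_1,\dots,M_r$, each the product of a $\{-1,1\}$-weighted sum of entries of $A$ and a $\{-1,1\}$-weighted sum of entries of $B$, such that every entry of $AB$ is a $\{-1,1\}$-weighted sum of some of the $M_i$, identically in the $T\times T$ matrices $A,B$. Put $\omega=\log_T r$, and let $N$ range over the powers $N=T^l$. A threshold circuit is a finite acyclic network of gates of unbounded fan-in, where a gate with binary inputs $y_1,\dots,y_n$, integer weights $w_i$ and integer threshold $t$ outputs $1$ if and only if $\sum_i w_iy_i\ge t$; its size is its number of gates, and its depth is the length of a longest directed path from an input to an output. An integer $x$ is given by the binary digits of two nonnegative integers $x^+,x^-$ with $x=x^+-x^-$, and we say that $x$ has $b$ bits if $x^+$ and $x^-$ have at most $b$ bits each. Let $b(N)=O(\log N)$. Then there is a family of threshold circuits, one for each $N$, such that the circuit for $N$ computes the matrix product $AB$ (with $O(\log N)$-bit entries) of any two $N\times N$ integer matrices $A,B$ with $b(N)$-bit entries, has depth $O(\log\log N)$, and has $\widetilde{O}(N^{\omega})$ gates, that is, $O(N^{\omega}(\log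 N)^k)$ gates for some constant $k$. The implied constants and $k$ may depend on the given algorithm and on the function $b$, but not on $N$. -/

import Mathlib

open Filter Asymptotics

/-- A bilinear algorithm that multiplies two `T × T` matrices with `r` multiplications.
The multiplication `M m` is the product of a `{-1, 1}`-weighted sum of entries of `A` and a
`{-1, 1}`-weighted sum of entries of `B`, and each entry of the product is a `{-1, 1}`-weighted sum
of the `M m`. The weight `0` means that the term does not appear.
(Since the identity `correct` is bilinear, its validity for integer matrices is equivalent to its
validity for matrices over any ring, in particular for matrices of blocks.) -/
structure FastMatMul (T r : ℕ) where
  /-- weight of the entry `(p, q)` of `A` in the first factor of the multiplication `m` -/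
  wA : Fin r → Fin T → Fin T → ℤ
  /-- weight of the entry `(p, q)` of `B` in the second factor of the multiplication `m` -/
  wB : Fin r → Fin T → Fin T → ℤ
  /-- weight of the multiplication `m` in the expression for the entry `(i, j)` of the product -/
  wC : Fin T → Fin T → Fin r → ℤ
  wA_mem : ∀ m p q, wA m p q = -1 ∨ wA m p q = 0 ∨ wA m p q = 1
  wB_mem : ∀ m p q, wB m p q = -1 ∨ wB m p q = 0 ∨ wB m p q = 1
  wC_mem : ∀ i j m, wC i j m = -1 ∨ wC i j m = 0 ∨ wC i j m = 1
  correct : ∀ (A B : Matrix (Fin T) (Fin T) ℤ) (i j : Fin T),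
    (A * B) i j =
      ∑ m, wC i j m * ((∑ p, ∑ q, wA m p q * A p q) * (∑ p, ∑ q, wB m p q * B p q))

/-- A threshold circuit with input nodes `ι` and outputs labelled by `κ`: a finite acyclic network
of linear threshold gates with integer weights and thresholds and unbounded fan-in.
There is a wire from a node to a gate exactly when the corresponding weight is nonzero. -/
structure ThresholdCircuit (ι κ : Type) where
  /-- the gates -/
  Gate : Type
  [fintypeGate : Fintype Gate]
  /-- `inputWeight g i` is the weight of the wire from the input `i` to the gate `g` -/
  inputWeight : Gate → ι → ℤ
  /-- `gateWeight g h` is the weight of the wire from the gate `h` to the gate `g` -/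
  gateWeight : Gate → Gate → ℤ
  /-- the threshold of a gate -/
  threshold : Gate → ℤ
  /-- there is no directed cycle -/
  acyclic : WellFounded fun h g : Gate => gateWeight g h ≠ 0
  /-- the node (an input or a gate) at which an output is read -/
  output : κ → ι ⊕ Gate

namespace ThresholdCircuit

attribute [instance] ThresholdCircuit.fintypeGate

variable {ι κ : Type}

/-- The value of a gate on the input `x`: it is `1` if and only if the weighted sum of the values of
its in-neighbours is at least its threshold (see `gateValue_eq_true_iff`). -/
noncomputable def gateValue [Fintype ι] (C : ThresholdCircuit ι κ) (x : ι → Bool) : C.Gate → Bool :=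
  C.acyclic.fix fun g value =>
    decide (C.threshold g ≤ ∑ i, C.inputWeight g i * (x i).toInt +
      ∑ h, if hw : C.gateWeight g h ≠ 0 then C.gateWeight g h * (value h hw).toInt else 0)

theorem gateValue_eq_true_iff [Fintype ι] (C : ThresholdCircuit ι κ) (x : ι → Bool) (g : C.Gate) :
    C.gateValue x g = true ↔
      C.threshold g ≤ ∑ i, C.inputWeight g i * (x i).toInt +
        ∑ h, C.gateWeight g h * (C.gateValue x h).toInt := by
  have hsum : ∀ h, (if _hw : C.gateWeight g h ≠ 0 then
      C.gateWeight g h * (C.gateValue x h).toInt else 0) =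
      C.gateWeight g h * (C.gateValue x h).toInt := by
    intro h
    by_cases hw : C.gateWeight g h = 0 <;> simp [hw]
  rw [← Finset.sum_congr rfl (fun h _ => hsum h)]
  conv_lhs => rw [gateValue, WellFounded.fix_eq]
  rw [decide_eq_true_iff]
  rfl

/-- The values that the circuit outputs on the input `x`. -/
noncomputable def compute [Fintype ι] (C : ThresholdCircuit ι κ) (x : ι → Bool) (k : κ) : Bool :=
  Sum.elim x (C.gateValue x) (C.output k)

/-- The size of a circuit: its number of gates. -/
def size (C : ThresholdCircuit ι κ) : ℕ := Fintype.card C.Gate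

/-- The depth of a gate: the length (number of wires) of a longest directed path from an input node
to the gate; a gate with no incoming wire from another gate has depth `1`
(see `gateDepth_eq`). -/
noncomputable def gateDepth (C : ThresholdCircuit ι κ) : C.Gate → ℕ :=
  C.acyclic.fix fun g depth =>
    1 + Finset.univ.sup fun h => if hw : C.gateWeight g h ≠ 0 then depth h hw else 0

open Classical in
theorem gateDepth_eq (C : ThresholdCircuit ι κ) (g : C.Gate) :
    C.gateDepth g =
      1 + (Finset.univ.filter fun h => C.gateWeight g h ≠ 0).sup C.gateDepth := by
  conv_lhs => rw [gateDepth, WellFounded.fix_eq]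
  congr 1
  apply le_antisymm
  · refine Finset.sup_le fun h _ => ?_
    by_cases hw : C.gateWeight g h ≠ 0
    · rw [dif_pos hw]
      exact Finset.le_sup (f := C.gateDepth) (Finset.mem_filter.2 ⟨Finset.mem_univ h, hw⟩)
    · rw [dif_neg hw]
      exact Nat.zero_le _
  · refine Finset.sup_le fun h hh => ?_
    have hw := (Finset.mem_filter.1 hh).2
    refine le_trans ?_ (Finset.le_sup (Finset.mem_univ h))
    rw [dif_pos hw]
    rfl

/-- The depth of a circuit: the length of a longest directed path from an input node to an output
node. -/
noncomputable def depth [Fintype κ] (C : ThresholdCircuit ι κ) : ℕ :=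
  Finset.univ.sup fun k => Sum.elim (fun _ => 0) C.gateDepth (C.output k)

end ThresholdCircuit

/-- The nonnegative integer with the binary digits `d`, least significant digit first. -/
def binaryValue {b : ℕ} (d : Fin b → Bool) : ℤ := ∑ t : Fin b, (d t).toInt * 2 ^ (t : ℕ)

/-- The positions of the bits of an `N × N` integer matrix: each entry `x` is given as a difference
`x⁺ - x⁻` of two nonnegative integers of `b` bits each. The position `(i, j, true, t)` is that of
the bit of weight `2 ^ t` of `x⁺`, and `(i, j, false, t)` that of `x⁻`, for `x` the entry `(i, j)`. -/
abbrev MatrixBits (N b : ℕ) : Type := Fin N × Fin N × Bool × Fin b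

/-- The bits `d` represent the integer matrix `A`. -/
def Represents {N b : ℕ} (d : MatrixBits N b → Bool) (A : Matrix (Fin N) (Fin N) ℤ) : Prop :=
  ∀ i j, A i j = binaryValue (fun t => d (i, j, true, t)) - binaryValue (fun t => d (i, j, false, t))

/-- The circuit computes the product of any two `N × N` integer matrices whose entries require at
most `b` bits, with `m`-bit entries in the output: whatever bits represent `A` and `B` at the
inputs, the output bits represent `A * B`. -/
def ComputesMatrixProduct {N b m : ℕ}
    (C : ThresholdCircuit (MatrixBits N b ⊕ MatrixBits N b) (MatrixBits N m)) : Prop :=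
  ∀ (A B : Matrix (Fin N) (Fin N) ℤ) (x y : MatrixBits N b → Bool),
    Represents x A → Represents y B → Represents (C.compute (Sum.elim x y)) (A * B)

/-! Put `q = T ^ 2`. The `l`-th Kronecker power of the algorithm multiplies `T ^ l × T ^ l` matrices
by `r ^ l` products of linear forms in the entries (`correct_pow`). The linear forms, and likewise
the recombination of the products, are given by a Kronecker power of one small matrix, so they can
be evaluated in stages, a block of tensor coordinates at a time.

Once the first `h` coordinates are treated there are `r ^ h * q ^ (l - h)` numbers. To pass to `h'`,
each new number is a signed sum of at most `q ^ (h' - h)` old ones, so the stage has about `r ^ h' *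
q ^ (l - h)` summands (`partialPower_step`). A single stage would be too large, and one coordinate
per stage too deep. As `q < r`, some `e` has `q ^ (e + 1) ≤ r ^ e`; treating a fraction `1 / (e +
1)` of the remaining coordinates, rounded up, keeps every stage within `r ^ (l + 1)` summands
(`pow_mul_pow_remaining_le`) and needs only `O(log l)` stages (`remaining_eq_zero`). Recombination
runs the same schedule backwards.

A stage has depth two: a bit of a weighted sum of `n` bits takes `2 * n + 1` gates, whatever the
weights (`Realizes.weightedSum`). All numbers have `O(log N)` bits, so bit operations cost
polylogarithmic factors. -/

namespace ThresholdCircuit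

/-! ### Composition of threshold circuits -/

variable {ι κ κ' : Type}

theorem gateDepth_le (C : ThresholdCircuit ι κ) (g : C.Gate) (n : ℕ)
    (h : ∀ g', C.gateWeight g g' ≠ 0 → C.gateDepth g' ≤ n) : C.gateDepth g ≤ n + 1 := by
  classical
  rw [gateDepth_eq, add_comm]
  exact Nat.add_le_add_right (Finset.sup_le fun g' hg' => h g' (Finset.mem_filter.1 hg').2) 1

theorem gateDepth_lt (C : ThresholdCircuit ι κ) (g g' : C.Gate) (h : C.gateWeight g g' ≠ 0) :
    C.gateDepth g' < C.gateDepth g := by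
  classical
  rw [C.gateDepth_eq g, add_comm]
  exact Nat.lt_succ_of_le
    (Finset.le_sup (f := C.gateDepth) (Finset.mem_filter.2 ⟨Finset.mem_univ g', h⟩))

theorem gateDepth_pos (C : ThresholdCircuit ι κ) (g : C.Gate) : 0 < C.gateDepth g := by
  classical
  rw [gateDepth_eq]
  omega

/-- A map of gates that preserves the weights of wires and all incoming wires of its image
preserves the values of gates. -/
theorem gateValue_map [Fintype ι] (C : ThresholdCircuit ι κ) (D : ThresholdCircuit ι κ')
    (e : C.Gate → D.Gate) (he : Function.Injective e)
    (hin : ∀ g i, D.inputWeight (e g) i = C.inputWeight g i)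
    (hgate : ∀ g h, D.gateWeight (e g) (e h) = C.gateWeight g h)
    (hout : ∀ g h, h ∉ Set.range e → D.gateWeight (e g) h = 0)
    (hthr : ∀ g, D.threshold (e g) = C.threshold g) (x : ι → Bool) (g : C.Gate) :
    D.gateValue x (e g) = C.gateValue x g := by
  induction g using C.acyclic.induction with
  | _ g ih =>
    rw [Bool.eq_iff_iff, gateValue_eq_true_iff, gateValue_eq_true_iff, hthr]
    have h1 : ∑ h, D.gateWeight (e g) h * (D.gateValue x h).toInt =
        ∑ h, C.gateWeight g h * (C.gateValue x h).toInt := by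
      symm
      refine Finset.sum_of_injOn e (fun _ _ _ _ h => he h) (fun _ _ => Finset.mem_univ _) ?_ ?_
      · intro h _ hh
        rw [hout g h (by simpa using hh), zero_mul]
      · intro h _
        rw [hgate]
        by_cases hw : C.gateWeight g h = 0
        · simp [hw]
        · rw [ih h hw]
    simp only [h1, hin]

theorem gateDepth_map (C : ThresholdCircuit ι κ) (D : ThresholdCircuit ι κ')
    (e : C.Gate → D.Gate)
    (hgate : ∀ g h, D.gateWeight (e g) (e h) = C.gateWeight g h)
    (hout : ∀ g h, h ∉ Set.range e → D.gateWeight (e g) h = 0) (g : C.Gate) :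
    D.gateDepth (e g) ≤ C.gateDepth g := by
  induction g using C.acyclic.induction with
  | _ g ih =>
    have hpos := C.gateDepth_pos g
    refine (D.gateDepth_le (e g) (C.gateDepth g - 1) fun h hh => ?_).trans (by omega)
    by_cases hr : h ∈ Set.range e
    · obtain ⟨h, rfl⟩ := hr
      rw [hgate] at hh
      have := ih h hh
      have := C.gateDepth_lt g h hh
      omega
    · exact absurd (hout g h hr) hh

/-- The circuit obtained from `C` by adding a layer of threshold gates, labelled by `κ'`, whose
in-neighbours are the output nodes of `C`. -/
noncomputable def addLayer [Fintype κ] [Fintype κ'] (C : ThresholdCircuit ι κ)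
    (W : κ' → κ → ℤ) (θ : κ' → ℤ) : ThresholdCircuit ι κ' where
  Gate := C.Gate ⊕ κ'
  inputWeight := open Classical in Sum.elim C.inputWeight
    -- Several outputs may be read at the same node, so their weights add up.
    (fun k' i => ∑ k, if C.output k = Sum.inl i then W k' k else 0)
  gateWeight := open Classical in Sum.elim
    (fun g => Sum.elim (C.gateWeight g) fun _ => 0)
    (fun k' => Sum.elim (fun h => ∑ k, if C.output k = Sum.inr h then W k' k else 0) fun _ => 0)
  threshold := Sum.elim C.threshold θ
  acyclic := by
    have hl : ∀ g : C.Gate, Acc (fun h g : C.Gate ⊕ κ' => (open Classical in Sum.elim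
        (fun g => Sum.elim (C.gateWeight g) fun _ => 0)
        (fun k' => Sum.elim (fun h => ∑ k, if C.output k = Sum.inr h then W k' k else 0)
          fun _ => 0) g h : ℤ) ≠ 0) (Sum.inl g) := by
      intro g
      induction g using C.acyclic.induction with
      | _ g ih =>
        refine ⟨_, ?_⟩
        rintro (h | h) hh
        · exact ih h hh
        · exact absurd rfl hh
    refine ⟨?_⟩
    rintro (g | k')
    · exact hl g
    · refine ⟨_, ?_⟩
      rintro (h | h) hh
      · exact hl h
      · exact absurd rfl hh
  output k' := Sum.inr (Sum.inr k')

/-- Two circuits side by side. -/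
noncomputable def parallel (C : ThresholdCircuit ι κ) (D : ThresholdCircuit ι κ') :
    ThresholdCircuit ι (κ ⊕ κ') where
  Gate := C.Gate ⊕ D.Gate
  inputWeight := Sum.elim C.inputWeight D.inputWeight
  gateWeight := Sum.elim (fun g => Sum.elim (C.gateWeight g) fun _ => 0)
    (fun g => Sum.elim (fun _ => 0) (D.gateWeight g))
  threshold := Sum.elim C.threshold D.threshold
  acyclic := by
    refine ⟨?_⟩
    rintro (g | g)
    · induction g using C.acyclic.induction with
      | _ g ih =>
        refine ⟨_, ?_⟩
        rintro (h | h) hh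
        · exact ih h hh
        · exact absurd rfl hh
    · induction g using D.acyclic.induction with
      | _ g ih =>
        refine ⟨_, ?_⟩
        rintro (h | h) hh
        · exact absurd rfl hh
        · exact ih h hh
  output := Sum.elim (fun k => Sum.map id Sum.inl (C.output k))
    (fun k => Sum.map id Sum.inr (D.output k))

/-- The function `f` is computed by a threshold circuit with at most `s` gates, at whose outputs the
depth is at most `d`. -/
def Realizes [Fintype ι] (f : (ι → Bool) → κ → Bool) (s d : ℕ) : Prop :=
  ∃ C : ThresholdCircuit ι κ, (∀ x, C.compute x = f x) ∧ C.size ≤ s ∧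
    ∀ k, Sum.elim (fun _ => 0) C.gateDepth (C.output k) ≤ d

namespace Realizes

variable [Fintype ι] {f : (ι → Bool) → κ → Bool} {s d : ℕ}

theorem input (φ : κ → ι) : Realizes (fun x k => x (φ k)) 0 0 :=
  ⟨{ Gate := Empty
     inputWeight := fun g => g.elim
     gateWeight := fun g => g.elim
     threshold := fun g => g.elim
     acyclic := ⟨fun g => g.elim⟩
     output := fun k => Sum.inl (φ k) }, fun _ => rfl, by simp [size], fun _ => le_rfl⟩

theorem comp_output (hf : Realizes f s d) (φ : κ' → κ) :
    Realizes (fun x k => f x (φ k)) s d := by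
  obtain ⟨C, hC, hs, hd⟩ := hf
  let D : ThresholdCircuit ι κ' := { C with output := fun k => C.output (φ k) }
  refine ⟨D, fun x => ?_, hs, fun k => hd (φ k)⟩
  funext k
  exact congrFun (hC x) (φ k)

theorem mono (hf : Realizes f s d) {s' d' : ℕ} (hs : s ≤ s') (hd : d ≤ d') :
    Realizes f s' d' := by
  obtain ⟨C, hC, hs', hd'⟩ := hf
  exact ⟨C, hC, hs'.trans hs, fun k => (hd' k).trans hd⟩

theorem congr (hf : Realizes f s d) {f' : (ι → Bool) → κ → Bool} (h : ∀ x k, f' x k = f x k) :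
    Realizes f' s d := by
  have : f' = f := funext fun x => funext fun k => h x k
  rwa [this]

theorem layer [Fintype κ] [Fintype κ'] (hf : Realizes f s d) (W : κ' → κ → ℤ) (θ : κ' → ℤ) :
    Realizes (fun x k' => decide (θ k' ≤ ∑ k, W k' k * (f x k).toInt))
      (s + Fintype.card κ') (d + 1) := by
  classical
  obtain ⟨C, hC, hs, hd⟩ := hf
  have hout : ∀ (g : C.Gate) (h : (C.addLayer W θ).Gate), h ∉ Set.range Sum.inl →
      (C.addLayer W θ).gateWeight (Sum.inl g) h = 0 := by
    rintro g (h | h) hh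
    · exact absurd ⟨h, rfl⟩ hh
    · rfl
  refine ⟨C.addLayer W θ, fun x => funext fun k' => ?_, ?_, fun k' => ?_⟩
  · have hval : ∀ g, (C.addLayer W θ).gateValue x (Sum.inl g) = C.gateValue x g :=
      gateValue_map C (C.addLayer W θ) Sum.inl Sum.inl_injective (fun _ _ => rfl)
        (fun _ _ => rfl) hout (fun _ => rfl) x
    rw [Bool.eq_iff_iff, decide_eq_true_iff]
    refine ((C.addLayer W θ).gateValue_eq_true_iff x (Sum.inr k')).trans ?_
    have h1 : ∑ h, (C.addLayer W θ).gateWeight (Sum.inr k') h *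
        ((C.addLayer W θ).gateValue x h).toInt =
        ∑ h : C.Gate, (∑ k, if C.output k = Sum.inr h then W k' k else 0) *
          (C.gateValue x h).toInt := by
      refine (Fintype.sum_sum_type _).trans ?_
      simp only [hval]
      simp [addLayer]
    have h2 : ∀ k, (f x k).toInt = ∑ i, (if C.output k = Sum.inl i then (x i).toInt else 0) +
        ∑ h, (if C.output k = Sum.inr h then (C.gateValue x h).toInt else 0) := by
      intro k
      rw [← hC x, compute]
      rcases C.output k with i | h <;> simp
    rw [h1]
    have h3 : ∑ i, (C.addLayer W θ).inputWeight (Sum.inr k') i * (x i).toInt +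
        ∑ h : C.Gate, (∑ k, if C.output k = Sum.inr h then W k' k else 0) *
          (C.gateValue x h).toInt = ∑ k, W k' k * (f x k).toInt := by
      simp only [h2, mul_add, Finset.sum_add_distrib, Finset.mul_sum, addLayer, Sum.elim_inr,
        Finset.sum_mul]
      congr 1 <;>
      · rw [Finset.sum_comm]
        refine Finset.sum_congr rfl fun _ _ => Finset.sum_congr rfl fun _ _ => ?_
        split_ifs <;> simp
    rw [h3]
    rfl
  · exact (Fintype.card_sum).trans_le (Nat.add_le_add_right hs _)
  · refine gateDepth_le (C.addLayer W θ) (Sum.inr k') d ?_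
    rintro (h | h) hh
    · refine (gateDepth_map C (C.addLayer W θ) Sum.inl (fun _ _ => rfl) hout h).trans ?_
      -- A nonzero wire weight forces some output of `C` to be read at `h`, which bounds the depth
      -- of `h`.
      obtain ⟨k, -, hk⟩ := Finset.exists_ne_zero_of_sum_ne_zero hh
      have hk' : C.output k = Sum.inr h := by
        by_contra hne
        exact hk (if_neg hne)
      simpa [hk'] using hd k
    · exact absurd rfl hh

theorem parallel {g : (ι → Bool) → κ' → Bool} {s' : ℕ} (hf : Realizes f s d)
    (hg : Realizes g s' d) : Realizes (fun x => Sum.elim (f x) (g x)) (s + s') d := by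
  obtain ⟨C, hC, hs, hd⟩ := hf
  obtain ⟨D, hD, hs', hd'⟩ := hg
  have hl : ∀ (g : C.Gate) (h : (C.parallel D).Gate), h ∉ Set.range Sum.inl →
      (C.parallel D).gateWeight (Sum.inl g) h = 0 := by
    rintro g (h | h) hh
    · exact absurd ⟨h, rfl⟩ hh
    · rfl
  have hr : ∀ (g : D.Gate) (h : (C.parallel D).Gate), h ∉ Set.range Sum.inr →
      (C.parallel D).gateWeight (Sum.inr g) h = 0 := by
    rintro g (h | h) hh
    · rfl
    · exact absurd ⟨h, rfl⟩ hh
  refine ⟨C.parallel D, fun x => ?_, ?_, ?_⟩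
  · have hvl := gateValue_map C (C.parallel D) Sum.inl Sum.inl_injective (fun _ _ => rfl)
      (fun _ _ => rfl) hl (fun _ => rfl) x
    have hvr := gateValue_map D (C.parallel D) Sum.inr Sum.inr_injective (fun _ _ => rfl)
      (fun _ _ => rfl) hr (fun _ => rfl) x
    change _ = Sum.elim (f x) (g x)
    rw [← hC x, ← hD x]
    funext k
    rcases k with k | k
    · change Sum.elim x _ (Sum.map id Sum.inl (C.output k)) = Sum.elim x _ (C.output k)
      rcases C.output k with i | h
      · rfl
      · exact hvl h
    · change Sum.elim x _ (Sum.map id Sum.inr (D.output k)) = Sum.elim x _ (D.output k)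
      rcases D.output k with i | h
      · rfl
      · exact hvr h
  · exact (Fintype.card_sum).trans_le (Nat.add_le_add hs hs')
  · rintro (k | k)
    · refine le_trans ?_ (hd k)
      change Sum.elim _ _ (Sum.map id Sum.inl (C.output k)) ≤ _
      rcases C.output k with i | h
      · exact le_rfl
      · exact gateDepth_map C (C.parallel D) Sum.inl (fun _ _ => rfl) hl h
    · refine le_trans ?_ (hd' k)
      change Sum.elim _ _ (Sum.map id Sum.inr (D.output k)) ≤ _
      rcases D.output k with i | h
      · exact le_rfl
      · exact gateDepth_map D (C.parallel D) Sum.inr (fun _ _ => rfl) hr h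

end Realizes

end ThresholdCircuit

/-! ### Binary digits and their extraction by threshold gates -/

theorem Bool.natCast_toNat_eq_toInt (a : Bool) : (a.toNat : ℤ) = a.toInt := by
  cases a <;> rfl

theorem Nat.sum_testBit_mul_two_pow {m n : ℕ} (h : n < 2 ^ m) :
    ∑ t : Fin m, (n.testBit t).toNat * 2 ^ (t : ℕ) = n := by
  have key : ∀ m, ∑ t ∈ Finset.range m, (n.testBit t).toNat * 2 ^ t = n % 2 ^ m := by
    intro m
    induction m with
    | zero => simp [Nat.mod_one]
    | succ m ih =>
      rw [Finset.sum_range_succ, ih, pow_succ, Nat.mod_mul, Nat.toNat_testBit, mul_comm (2 ^ m)]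
  rw [Fin.sum_univ_eq_sum_range (fun t => (n.testBit t).toNat * 2 ^ t), key, Nat.mod_eq_of_lt h]

theorem sum_bits_mul_two_pow_le {b : ℕ} (a : Fin b → Bool) :
    ∑ t : Fin b, (a t).toNat * 2 ^ (t : ℕ) ≤ 2 ^ b := by
  calc ∑ t : Fin b, (a t).toNat * 2 ^ (t : ℕ) ≤ ∑ t : Fin b, 2 ^ (t : ℕ) :=
        Finset.sum_le_sum fun t _ => mul_le_of_le_one_left (Nat.zero_le _) (Bool.toNat_le _)
    _ = ∑ t ∈ Finset.range b, 2 ^ t := Fin.sum_univ_eq_sum_range (fun t => 2 ^ t) b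
    _ ≤ 2 ^ b := (Nat.geomSum_lt le_rfl fun k hk => Finset.mem_range.1 hk).le

/-- Only the first `Q` terms of the alternating sum survive, and they cancel in pairs. This lets a
single gate read the parity of a number given in unary. -/
theorem sum_neg_one_pow_mul_decide_lt {N Q : ℕ} (h : Q ≤ N) :
    ∑ j : Fin N, (-1 : ℤ) ^ (j : ℕ) * (decide ((j : ℕ) < Q)).toInt = (Q % 2 : ℕ) := by
  rw [Fin.sum_univ_eq_sum_range (fun j => (-1 : ℤ) ^ j * (decide (j < Q)).toInt)]
  have h1 : ∑ j ∈ Finset.range N, (-1 : ℤ) ^ j * (decide (j < Q)).toInt =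
      ∑ j ∈ Finset.range Q, (-1 : ℤ) ^ j := by
    symm
    refine Finset.sum_subset_zero_on_sdiff (Finset.range_subset_range.2 h) ?_ ?_
    · intro j hj
      have : ¬ j < Q := by simpa using (Finset.mem_sdiff.1 hj).2
      simp [this]
    · intro j hj
      have : j < Q := by simpa using hj
      simp [this]
  rw [h1]
  induction Q with
  | zero => simp
  | succ Q ih =>
    rw [Finset.sum_range_succ, neg_one_geom_sum]
    rcases Nat.even_or_odd Q with hQ | hQ
    · rw [if_pos hQ, hQ.neg_one_pow]
      have := Nat.even_iff.1 hQ
      have : (Q + 1) % 2 = 1 := by omega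
      simp [this]
    · rw [if_neg (Nat.not_even_iff_odd.2 hQ), hQ.neg_one_pow]
      have := Nat.odd_iff.1 hQ
      have : (Q + 1) % 2 = 0 := by omega
      simp [this]

/-- A bit of a weighted sum of few bits is the parity of a number that is given in unary by
threshold gates. -/
theorem testBit_sum_eq_decide {κ : Type} [Fintype κ] (w : κ → ℕ) (y : κ → Bool) (n k : ℕ)
    (hn : (Finset.univ.filter fun i => w i ≠ 0).card ≤ n) :
    (∑ i, w i * (y i).toNat).testBit k =
      decide (1 ≤ ∑ j : Fin (2 * n), (-1 : ℤ) ^ (j : ℕ) *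
        (decide ((((j : ℕ) + 1) * 2 ^ k : ℤ) ≤
          ∑ i, ((w i % 2 ^ (k + 1) : ℕ) : ℤ) * (y i).toInt)).toInt) := by
  set S' := ∑ i, (w i % 2 ^ (k + 1)) * (y i).toNat with hS'
  have hcast : ∑ i, ((w i % 2 ^ (k + 1) : ℕ) : ℤ) * (y i).toInt = (S' : ℤ) := by
    rw [hS', Nat.cast_sum]
    refine Finset.sum_congr rfl fun i _ => ?_
    rw [Nat.cast_mul, Bool.natCast_toNat_eq_toInt]
  -- Bit `k` depends only on the sum modulo `2 ^ (k + 1)`. Reducing the weights makes `S' / 2 ^ k`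
  -- at most `2 * n`, however large the weights were; this is the length of the unary code.
  have hmod : (∑ i, w i * (y i).toNat) % 2 ^ (k + 1) = S' % 2 ^ (k + 1) := by
    rw [hS']
    refine Nat.ModEq.sum fun i _ => ?_
    exact ((Nat.mod_modEq _ _).symm).mul_right _
  have hbound : S' ≤ n * 2 ^ (k + 1) := by
    calc S' = ∑ i ∈ Finset.univ.filter (fun i => w i ≠ 0),
            (w i % 2 ^ (k + 1)) * (y i).toNat := by
          symm
          refine Finset.sum_subset (Finset.subset_univ _) fun i _ hi => ?_
          have : w i = 0 := by simpa using hi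
          simp [this]
      _ ≤ ∑ i ∈ Finset.univ.filter (fun i => w i ≠ 0), 2 ^ (k + 1) := by
          refine Finset.sum_le_sum fun i _ => ?_
          exact (mul_le_of_le_one_right (Nat.zero_le _) (Bool.toNat_le _)).trans
            (Nat.mod_lt _ (by positivity)).le
      _ ≤ n * 2 ^ (k + 1) := by
          rw [Finset.sum_const, smul_eq_mul]
          exact Nat.mul_le_mul_right _ hn
  have hQ : S' / 2 ^ k ≤ 2 * n := by
    refine Nat.div_le_of_le_mul (hbound.trans_eq ?_)
    ring
  have hgate : ∀ j : Fin (2 * n), decide ((((j : ℕ) + 1) * 2 ^ k : ℤ) ≤ (S' : ℤ)) =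
      decide ((j : ℕ) < S' / 2 ^ k) := by
    intro j
    rw [decide_eq_decide, Nat.lt_iff_add_one_le, Nat.le_div_iff_mul_le (by positivity)]
    norm_cast
  rw [hcast]
  simp only [hgate]
  rw [sum_neg_one_pow_mul_decide_lt hQ]
  have h1 : (∑ i, w i * (y i).toNat).testBit k = S'.testBit k := by
    have h2 := congrArg (fun a => a.testBit k) hmod
    simpa [Nat.testBit_mod_two_pow] using h2
  rw [h1, Nat.testBit_eq_decide_div_mod_eq, decide_eq_decide]
  have := Nat.mod_lt (S' / 2 ^ k) (by norm_num : 0 < 2)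
  norm_cast
  omega

/-! ### Arithmetic in constant depth -/

namespace ThresholdCircuit

variable {ι κ X Y : Type} [Fintype ι]

/-- For each bit, a first layer of `2 * n` gates produces the unary code and one gate of a second
layer takes its parity. The cost depends on the number of nonzero weights and not on their size, so
place values `2 ^ t` are free. -/
theorem Realizes.weightedSum [Fintype κ] [Fintype Y] {f : (ι → Bool) → κ → Bool} {s d : ℕ} (hf : Realizes f s d)
    (w : Y → κ → ℕ) (n m : ℕ)
    (hn : ∀ o, (Finset.univ.filter fun i => w o i ≠ 0).card ≤ n) :
    Realizes (fun x (p : Y × Fin m) => (∑ i, w p.1 i * (f x i).toNat).testBit p.2)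
      (s + Fintype.card Y * m * (2 * n + 1)) (d + 2) := by
  classical
  have h := (hf.layer (κ' := (Y × Fin m) × Fin (2 * n))
      (fun q i => ((w q.1.1 i % 2 ^ ((q.1.2 : ℕ) + 1) : ℕ) : ℤ))
      (fun q => (((q.2 : ℕ) + 1) * 2 ^ (q.1.2 : ℕ) : ℤ))).layer (κ' := Y × Fin m)
      (fun p q => if q.1 = p then (-1 : ℤ) ^ (q.2 : ℕ) else 0) (fun _ => 1)
  refine (h.mono (le_of_eq ?_) le_rfl).congr fun x p => ?_
  · simp only [Fintype.card_prod, Fintype.card_fin]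
    ring
  · rw [testBit_sum_eq_decide (w p.1) (f x) n p.2 (hn p.1), Fintype.sum_prod_type]
    rw [Finset.sum_eq_single p]
    · simp
    · intro q _ hq
      simp [hq]
    · simp

/-- The numbers `V x c`, where `x` is the input, are computed as differences of two nonnegative
integers that are at most `B` and of which the lowest `m` bits are output. -/
def ComputesSigned (m : ℕ) (V : (ι → Bool) → X → ℤ) (B s d : ℕ) : Prop :=
  ∃ u : (ι → Bool) → X × Bool → ℕ, (∀ x p, u x p ≤ B) ∧
    (∀ x c, V x c = u x (c, true) - u x (c, false)) ∧
    Realizes (fun x (p : (X × Bool) × Fin m) => (u x p.1).testBit p.2) s d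

namespace ComputesSigned

variable {m B s d : ℕ} {V : (ι → Bool) → X → ℤ}

theorem congr (hV : ComputesSigned m V B s d) {V' : (ι → Bool) → X → ℤ}
    (h : ∀ x c, V' x c = V x c) : ComputesSigned m V' B s d := by
  have : V' = V := funext fun x => funext fun c => h x c
  rwa [this]

theorem mono (hV : ComputesSigned m V B s d) {B' s' d' : ℕ} (hB : B ≤ B') (hs : s ≤ s')
    (hd : d ≤ d') : ComputesSigned m V B' s' d' := by
  obtain ⟨u, hu, hVu, hR⟩ := hV
  exact ⟨u, fun x p => (hu x p).trans hB, hVu, hR.mono hs hd⟩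

/-- Recomputing the digits as a weighted sum pads them to `m` bits: the zeros beyond position `b`
are not available at any input node. -/
theorem input [Fintype X] {b : ℕ} (m : ℕ) (φ : (X × Bool) × Fin b → ι) :
    ComputesSigned m (fun x c => binaryValue (fun t => x (φ ((c, true), t))) -
      binaryValue (fun t => x (φ ((c, false), t)))) (2 ^ b)
      (Fintype.card X * 2 * m * (2 * b + 1)) 2 := by
  classical
  have h := (Realizes.input φ).weightedSum
    (fun p q => if q.1 = p then 2 ^ (q.2 : ℕ) else 0) b m (fun p => by
      calc (Finset.univ.filter fun q : (X × Bool) × Fin b =>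
              (if q.1 = p then 2 ^ (q.2 : ℕ) else 0) ≠ 0).card
          ≤ ((Finset.univ : Finset (Fin b)).image fun t => (p, t)).card := by
            refine Finset.card_le_card fun q hq => ?_
            rw [Finset.mem_image]
            refine ⟨q.2, Finset.mem_univ _, ?_⟩
            have : q.1 = p := by
              by_contra hne
              simp [hne] at hq
            rw [← this]
        _ ≤ b := Finset.card_image_le.trans_eq (by simp))
  refine ⟨fun x p => ∑ t : Fin b, (x (φ (p, t))).toNat * 2 ^ (t : ℕ), fun x p => ?_,
    fun x c => ?_, ?_⟩
  · exact sum_bits_mul_two_pow_le _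
  · simp [binaryValue, Bool.natCast_toNat_eq_toInt]
  · refine (h.mono (le_of_eq ?_) le_rfl).congr fun x p => ?_
    · simp
    · congr 1
      rw [Fintype.sum_prod_type, Finset.sum_eq_single p.1]
      · simp [mul_comm]
      · intro q _ hq
        simp [hq]
      · simp

/-- Sums with weights in `{-1, 0, 1}`. -/
theorem mulVec [Fintype X] [Fintype Y] (hV : ComputesSigned m V B s d) (hB : B < 2 ^ m) (W : Y → X → ℤ) (n : ℕ)
    (hW : ∀ y c, |W y c| ≤ 1) (hn : ∀ y, (Finset.univ.filter fun c => W y c ≠ 0).card ≤ n) :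
    ComputesSigned m (fun x y => ∑ c, W y c * V x c) (n * B)
      (s + Fintype.card Y * 2 * m * (2 * (n * 2 * m) + 1)) (d + 2) := by
  classical
  obtain ⟨u, hu, hVu, hR⟩ := hV
  -- The positive part of the result collects positive parts with weight `1` and negative parts with
  -- weight `-1`; the negative part collects the others. All weights become nonnegative.
  let W' : Y × Bool → X × Bool → ℕ := fun p q =>
    if p.2 = q.2 then (W p.1 q.1).toNat else (-W p.1 q.1).toNat
  have hW0 : ∀ p q, W' p q ≠ 0 → W p.1 q.1 ≠ 0 := by
    intro p q h h0
    simp [W', h0] at h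
  have h := hR.weightedSum (fun p q => W' p q.1 * 2 ^ (q.2 : ℕ)) (n * 2 * m) m (fun p => by
      calc (Finset.univ.filter fun q : (X × Bool) × Fin m => W' p q.1 * 2 ^ (q.2 : ℕ) ≠ 0).card
          ≤ (((Finset.univ.filter fun c => W p.1 c ≠ 0) ×ˢ (Finset.univ : Finset Bool)) ×ˢ
              (Finset.univ : Finset (Fin m))).card := by
            refine Finset.card_le_card fun q hq => ?_
            have : W' p q.1 ≠ 0 := by
              intro h0
              simp [h0] at hq
            simpa using hW0 _ _ this
        _ ≤ n * 2 * m := by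
            simp only [Finset.card_product, Finset.card_univ, Fintype.card_bool, Fintype.card_fin]
            exact Nat.mul_le_mul_right _ (Nat.mul_le_mul_right _ (hn p.1)))
  refine ⟨fun x p => ∑ q, W' p q * u x q, fun x p => ?_, fun x y => ?_, ?_⟩
  · calc ∑ q, W' p q * u x q = ∑ c, ∑ e, W' p (c, e) * u x (c, e) := Fintype.sum_prod_type _
      -- For each `c` at most one of the two signs contributes, so the bound is `n * B` without a
      -- factor `2`.
      _ ≤ ∑ c, if W p.1 c ≠ 0 then B else 0 := by
          refine Finset.sum_le_sum fun c _ => ?_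
          have hw := abs_le.1 (hW p.1 c)
          have ht := hu x (c, true)
          have hf := hu x (c, false)
          have h3 : W p.1 c = -1 ∨ W p.1 c = 0 ∨ W p.1 c = 1 := by omega
          obtain ⟨y, e⟩ := p
          simp only at h3
          rcases h3 with h3 | h3 | h3 <;> cases e <;> simp [W', h3, ht, hf]
      _ ≤ n * B := by
          rw [← Finset.sum_filter, Finset.sum_const, smul_eq_mul]
          exact Nat.mul_le_mul_right _ (hn p.1)
  · rw [Nat.cast_sum, Nat.cast_sum, ← Finset.sum_sub_distrib, Fintype.sum_prod_type]
    refine Finset.sum_congr rfl fun c _ => ?_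
    have h1 : ((W y c).toNat : ℤ) - (-W y c).toNat = W y c := Int.toNat_sub_toNat_neg _
    simp only [Fintype.sum_bool, W', hVu]
    generalize (W y c).toNat = a at h1 ⊢
    generalize (-W y c).toNat = a' at h1 ⊢
    simp
    linear_combination (-(u x (c, true) : ℤ) + u x (c, false)) * h1
  · refine (h.mono (le_of_eq ?_) le_rfl).congr fun x p => ?_
    · simp
    · congr 1
      rw [Fintype.sum_prod_type]
      refine Finset.sum_congr rfl fun q _ => ?_
      conv_lhs => rw [← Nat.sum_testBit_mul_two_pow ((hu x q).trans_lt hB)]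
      rw [Finset.mul_sum]
      refine Finset.sum_congr rfl fun t _ => ?_
      ring

/-- Expanding both factors into bits, a product is a weighted sum of conjunctions of two bits: one
layer of gates with threshold `2`, then a weighted sum. Products of parts of equal sign go to the
positive part and the others to the negative part; each receives two products, whence the factor `2`
in the bound. -/
theorem mul [Fintype X] (hV : ComputesSigned m V B s d) (hB : B < 2 ^ m) {V' : (ι → Bool) → X → ℤ}
    {B' s' : ℕ} (hV' : ComputesSigned m V' B' s' d) (hB' : B' < 2 ^ m) :
    ComputesSigned m (fun x c => V x c * V' x c) (2 * (B * B'))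
      (s + s' + Fintype.card X * (2 * m) ^ 2 +
        Fintype.card X * 2 * m * (2 * (2 * m) ^ 2 + 1)) (d + 3) := by
  classical
  obtain ⟨u, hu, hVu, hR⟩ := hV
  obtain ⟨u', hu', hVu', hR'⟩ := hV'
  have hand := (hR.parallel hR').layer (κ' := X × (Bool × Fin m) × (Bool × Fin m))
    (fun p => Sum.elim (fun q => if q = ((p.1, p.2.1.1), p.2.1.2) then 1 else 0)
      (fun q => if q = ((p.1, p.2.2.1), p.2.2.2) then 1 else 0)) (fun _ => 2)
  have hand' : Realizes (fun x (p : X × (Bool × Fin m) × (Bool × Fin m)) =>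
      (u x (p.1, p.2.1.1)).testBit p.2.1.2 && (u' x (p.1, p.2.2.1)).testBit p.2.2.2)
      (s + s' + Fintype.card X * (2 * m) ^ 2) (d + 1) := by
    refine (hand.mono (le_of_eq ?_) le_rfl).congr fun x p => ?_
    · simp only [Fintype.card_prod, Fintype.card_bool, Fintype.card_fin]
      ring
    · rw [Fintype.sum_sum_type]
      simp only [Sum.elim_inl, Sum.elim_inr, ite_mul, one_mul, zero_mul, Finset.sum_ite_eq',
        Finset.mem_univ, if_true]
      generalize (u x (p.1, p.2.1.1)).testBit p.2.1.2 = a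
      generalize (u' x (p.1, p.2.2.1)).testBit p.2.2.2 = a'
      cases a <;> cases a' <;> decide
  have h := hand'.weightedSum (Y := X × Bool)
    (fun p q => if q.1 = p.1 then (if p.2 = (q.2.1.1 == q.2.2.1) then
      2 ^ (q.2.1.2 : ℕ) * 2 ^ (q.2.2.2 : ℕ) else 0) else 0) ((2 * m) ^ 2) m (fun p => by
      calc (Finset.univ.filter fun q : X × (Bool × Fin m) × (Bool × Fin m) =>
              (if q.1 = p.1 then (if p.2 = (q.2.1.1 == q.2.2.1) then
                2 ^ (q.2.1.2 : ℕ) * 2 ^ (q.2.2.2 : ℕ) else 0) else 0) ≠ 0).card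
          ≤ ((Finset.univ : Finset ((Bool × Fin m) × (Bool × Fin m))).image
              fun t => (p.1, t)).card := by
            refine Finset.card_le_card fun q hq => ?_
            rw [Finset.mem_image]
            refine ⟨q.2, Finset.mem_univ _, ?_⟩
            have : q.1 = p.1 := by
              by_contra hne
              simp [hne] at hq
            rw [← this]
        _ ≤ (2 * m) ^ 2 := Finset.card_image_le.trans_eq (by
            simp only [Finset.card_univ, Fintype.card_prod, Fintype.card_bool, Fintype.card_fin]
            ring))
  refine ⟨fun x p => ∑ a, ∑ a', if p.2 = (a == a') then u x (p.1, a) * u' x (p.1, a') else 0,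
    fun x p => ?_, fun x c => ?_, ?_⟩
  · have hb : ∀ a a', u x (p.1, a) * u' x (p.1, a') ≤ B * B' :=
      fun a a' => Nat.mul_le_mul (hu x _) (hu' x _)
    have h1 := hb true true
    have h2 := hb true false
    have h3 := hb false true
    have h4 := hb false false
    obtain ⟨c, e⟩ := p
    cases e <;> simp at h1 h2 h3 h4 ⊢ <;> omega
  · simp [hVu, hVu']
    ring
  · refine (h.mono (le_of_eq ?_) le_rfl).congr fun x p => ?_
    · simp
    · congr 1
      rw [Fintype.sum_prod_type, Finset.sum_eq_single p.1.1]
      · simp only [if_true, Fintype.sum_prod_type]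
        refine Finset.sum_congr rfl fun a _ => ?_
        rw [Finset.sum_comm]
        refine Finset.sum_congr rfl fun a' _ => ?_
        split_ifs with hc
        · conv_lhs => rw [← Nat.sum_testBit_mul_two_pow ((hu x (p.1.1, a)).trans_lt hB),
            ← Nat.sum_testBit_mul_two_pow ((hu' x (p.1.1, a')).trans_lt hB')]
          rw [Finset.sum_mul_sum]
          refine Finset.sum_congr rfl fun t _ => Finset.sum_congr rfl fun t' _ => ?_
          generalize (u x (p.1.1, a)).testBit t = b1
          generalize (u' x (p.1.1, a')).testBit t' = b2
          cases b1 <;> cases b2 <;> simp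
        · simp
      · intro q _ hq
        simp [hq]
      · simp

end ComputesSigned

end ThresholdCircuit

/-! ### Kronecker powers and mixed indices -/

theorem Fin.prod_ite_lt {l h : ℕ} (hl : h ≤ l) (v u : ℕ) :
    ∏ k : Fin l, (if (k : ℕ) < h then v else u) = v ^ h * u ^ (l - h) := by
  obtain ⟨t, rfl⟩ := Nat.exists_eq_add_of_le hl
  rw [Fin.prod_univ_eq_prod_range (fun k => if k < h then v else u), Finset.prod_range_add]
  congr 1
  · rw [Finset.prod_congr rfl fun k hk => if_pos (Finset.mem_range.1 hk)]
    simp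
  · simp

theorem Fin.prod_ite_lt_ite_lt {l h h' : ℕ} (hh : h ≤ h') (hl : h' ≤ l) (u : ℕ) :
    ∏ k : Fin l, (if (k : ℕ) < h then 1 else if (k : ℕ) < h' then u else 1) = u ^ (h' - h) := by
  obtain ⟨t, rfl⟩ := Nat.exists_eq_add_of_le hh
  obtain ⟨t', rfl⟩ := Nat.exists_eq_add_of_le hl
  rw [Fin.prod_univ_eq_prod_range (fun k => if k < h then 1 else if k < h + t then u else 1),
    Finset.prod_range_add, Finset.prod_range_add,
    Finset.prod_congr rfl fun k hk => if_pos (Finset.mem_range.1 hk)]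
  rw [Finset.prod_congr (s₁ := Finset.range t) (g := fun _ => u) rfl fun k hk => by
    have := Finset.mem_range.1 hk
    rw [if_neg (by omega), if_pos (by omega)]]
  rw [Finset.prod_congr (s₁ := Finset.range t') (g := fun _ => 1) rfl fun k hk => by
    rw [if_neg (by omega), if_neg (by omega)]]
  simp

section PiKronecker

variable {K : Type} {l : ℕ}

/-- The Kronecker product of a family of matrices. -/
def piKronecker (M : Fin l → Matrix K K ℤ) : Matrix (Fin l → K) (Fin l → K) ℤ :=
  Matrix.of fun c x => ∏ k, M k (c k) (x k)

theorem piKronecker_mul [Fintype K] (M M' : Fin l → Matrix K K ℤ) :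
    piKronecker M * piKronecker M' = piKronecker fun k => M k * M' k := by
  classical
  ext c x
  simp only [piKronecker, Matrix.mul_apply, Matrix.of_apply]
  rw [Finset.prod_univ_sum, Fintype.piFinset_univ]
  exact Finset.sum_congr rfl fun y _ => Finset.prod_mul_distrib.symm

/-- The indices whose first `h` components are in `V` and the others in `U`. -/
def mixedIndices (l : ℕ) (U V : Finset K) (h : ℕ) : Finset (Fin l → K) :=
  Fintype.piFinset fun k => if (k : ℕ) < h then V else U

theorem card_mixedIndices (U V : Finset K) {h : ℕ} (hl : h ≤ l) :
    (mixedIndices l U V h).card = V.card ^ h * U.card ^ (l - h) := by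
  rw [mixedIndices, Fintype.card_piFinset, ← Fin.prod_ite_lt hl]
  exact Finset.prod_congr rfl fun k _ => by split_ifs <;> rfl

/-- The Kronecker power of `E` on the first `h` factors. -/
def partialPower [DecidableEq K] (l : ℕ) (E : Matrix K K ℤ) (h : ℕ) :
    Matrix (Fin l → K) (Fin l → K) ℤ :=
  piKronecker fun k => if (k : ℕ) < h then E else 1

/-- The Kronecker power of `E` on the factors from `h` to `h'`. -/
def intervalPower [DecidableEq K] (l : ℕ) (E : Matrix K K ℤ) (h h' : ℕ) :
    Matrix (Fin l → K) (Fin l → K) ℤ :=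
  piKronecker fun k => if (k : ℕ) < h then 1 else if (k : ℕ) < h' then E else 1

variable [DecidableEq K]

/-- By the mixed-product rule this is checked factor by factor, where at least one of the two
matrices is the identity. -/
theorem intervalPower_mul_partialPower [Fintype K] (E : Matrix K K ℤ) {h h' : ℕ} (hh : h ≤ h') :
    intervalPower l E h h' * partialPower l E h = partialPower l E h' := by
  rw [intervalPower, partialPower, partialPower, piKronecker_mul]
  congr 1
  funext k
  by_cases h1 : (k : ℕ) < h
  · simp [h1, h1.trans_le hh]
  · by_cases h2 : (k : ℕ) < h' <;> simp [h1, h2]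

theorem partialPower_zero (E : Matrix K K ℤ) : partialPower l E 0 = 1 := by
  ext c x
  simp [partialPower, piKronecker, Matrix.one_apply, Finset.prod_ite_zero, funext_iff]

variable {E : Matrix K K ℤ} {U V : Finset K} {h h' : ℕ}

theorem abs_intervalPower_le_one (hE : ∀ a b, |E a b| ≤ 1) (c x : Fin l → K) :
    |intervalPower l E h h' c x| ≤ 1 := by
  rw [intervalPower, piKronecker, Matrix.of_apply, Finset.abs_prod]
  refine Finset.prod_le_one (fun _ _ => abs_nonneg _) fun k _ => ?_
  have h1 : |(1 : Matrix K K ℤ) (c k) (x k)| ≤ 1 := by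
    rw [Matrix.one_apply]
    split_ifs <;> simp
  split_ifs
  · exact h1
  · exact hE _ _
  · exact h1

/-- Off the interval the factors are identities and force `x k = c k`. Hence a row has at most
`U.card ^ (h' - h)` nonzero entries when `h ≤ h' ≤ l`, which bounds the number of summands in a
stage. -/
theorem mem_of_intervalPower_ne_zero (hEU : ∀ a b, E a b ≠ 0 → b ∈ U) {c x : Fin l → K}
    (hcx : intervalPower l E h h' c x ≠ 0) :
    x ∈ Fintype.piFinset fun k : Fin l =>
      if (k : ℕ) < h then {c k} else if (k : ℕ) < h' then U else {c k} := by
  rw [Fintype.mem_piFinset]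
  intro k
  rw [intervalPower, piKronecker, Matrix.of_apply] at hcx
  have hk := Finset.prod_ne_zero_iff.1 hcx k (Finset.mem_univ k)
  have h1 : (1 : Matrix K K ℤ) (c k) (x k) ≠ 0 → x k = c k := by
    intro h
    by_contra hne
    exact h (Matrix.one_apply_ne' hne)
  split_ifs at hk ⊢
  · exact Finset.mem_singleton.2 (h1 hk)
  · exact hEU _ _ hk
  · exact Finset.mem_singleton.2 (h1 hk)

theorem mem_mixedIndices_of_intervalPower_ne_zero (hEU : ∀ a b, E a b ≠ 0 → b ∈ U)
    (hh : h ≤ h') {c x : Fin l → K} (hc : c ∈ mixedIndices l U V h')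
    (hcx : intervalPower l E h h' c x ≠ 0) : x ∈ mixedIndices l U V h := by
  have hx := mem_of_intervalPower_ne_zero hEU hcx
  rw [mixedIndices, Fintype.mem_piFinset] at hc ⊢
  rw [Fintype.mem_piFinset] at hx
  intro k
  have h1 := hc k
  have h2 := hx k
  by_cases hk : (k : ℕ) < h
  · have hk' : (k : ℕ) < h' := hk.trans_le hh
    simp only [hk, hk', if_true, Finset.mem_singleton] at h1 h2 ⊢
    rwa [h2]
  · by_cases hk' : (k : ℕ) < h'
    · simpa [hk, hk'] using h2
    · simp only [hk, hk', if_false, Finset.mem_singleton] at h1 h2 ⊢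
      rwa [h2]

end PiKronecker

/-! ### Evaluation of a Kronecker power in stages -/

namespace ThresholdCircuit.ComputesSigned

variable {ι K : Type} [Fintype ι] [Fintype K] [DecidableEq K] {l m B s d : ℕ}
  {E : Matrix K K ℤ} {U V : Finset K} {F : (ι → Bool) → (Fin l → K) → ℤ}

/-- The rows of the interval power at the new indices are supported on the old mixed indices, so the
numbers already computed suffice and `mulVec` applies with short rows. -/
theorem partialPower_step {h h' : ℕ} (hE : ∀ a b, |E a b| ≤ 1) (hEU : ∀ a b, E a b ≠ 0 → b ∈ U)
    (hh : h ≤ h') (hl : h' ≤ l) (hB : B < 2 ^ m)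
    (hF : ComputesSigned m
      (fun x (c : mixedIndices l U V h) => (partialPower l E h).mulVec (F x) c) B s d) :
    ComputesSigned m
      (fun x (c : mixedIndices l U V h') => (partialPower l E h').mulVec (F x) c)
      (U.card ^ (h' - h) * B)
      (s + (V.card ^ h' * U.card ^ (l - h')) * 2 * m * (2 * (U.card ^ (h' - h) * 2 * m) + 1))
      (d + 2) := by
  have key := hF.mulVec hB (Y := mixedIndices l U V h')
    (fun y c => intervalPower l E h h' y c) (U.card ^ (h' - h))
    (fun y c => abs_intervalPower_le_one hE _ _) (fun y => by
      calc (Finset.univ.filter fun c : mixedIndices l U V h =>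
              intervalPower l E h h' y c ≠ 0).card
          ≤ (Fintype.piFinset fun k : Fin l => if (k : ℕ) < h then {y.1 k} else
              if (k : ℕ) < h' then U else {y.1 k}).card := by
            refine Finset.card_le_card_of_injOn Subtype.val ?_ Subtype.val_injective.injOn
            intro c hc
            exact mem_of_intervalPower_ne_zero hEU (Finset.mem_filter.1 hc).2
        _ = U.card ^ (h' - h) := by
            rw [Fintype.card_piFinset, ← Fin.prod_ite_lt_ite_lt hh hl]
            exact Finset.prod_congr rfl fun k _ => by split_ifs <;> simp)
  rw [Fintype.card_coe, card_mixedIndices U V hl] at key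
  refine key.congr fun x c => ?_
  rw [← intervalPower_mul_partialPower E hh, ← Matrix.mulVec_mulVec]
  rw [Finset.sum_coe_sort (mixedIndices l U V h)
    (fun y => intervalPower l E h h' c y * (partialPower l E h).mulVec (F x) y)]
  symm
  refine Finset.sum_subset (Finset.subset_univ _) fun y _ hy => ?_
  by_cases h0 : intervalPower l E h h' c y = 0
  · rw [h0, zero_mul]
  · exact absurd (mem_mixedIndices_of_intervalPower_ne_zero hEU hh c.2 h0) hy

/-- The Kronecker power of `E` is applied in `n` stages: the stage `i` takes care of the factors
from `t i` to `t (i + 1)`. -/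
theorem partialPower_of_schedule (hE : ∀ a b, |E a b| ≤ 1) (hEU : ∀ a b, E a b ≠ 0 → b ∈ U)
    (hU : 0 < U.card) (hB : U.card ^ l * B < 2 ^ m)
    (hF : ComputesSigned m (fun x (c : mixedIndices l U V 0) => F x c) B s d)
    (t : ℕ → ℕ) (n R : ℕ) (ht0 : t 0 = 0) (htn : t n = l)
    (hmono : ∀ i < n, t i ≤ t (i + 1)) (htl : ∀ i, t i ≤ l)
    (hcost : ∀ i < n, V.card ^ t (i + 1) * U.card ^ (l - t i) ≤ R) :
    ComputesSigned m
      (fun x (c : mixedIndices l U V l) => (partialPower l E l).mulVec (F x) c)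
      (U.card ^ l * B) (s + n * (R * (2 * m * (4 * m + 1)))) (d + 2 * n) := by
  have key : ∀ i ≤ n, ComputesSigned m
      (fun x (c : mixedIndices l U V (t i)) => (partialPower l E (t i)).mulVec (F x) c)
      (U.card ^ t i * B) (s + i * (R * (2 * m * (4 * m + 1)))) (d + 2 * i) := by
    intro i
    induction i with
    | zero =>
      intro _
      rw [ht0]
      simpa [partialPower_zero] using hF
    | succ i ih =>
      intro hi
      have hBi : U.card ^ t i * B < 2 ^ m :=
        (Nat.mul_le_mul_right _ (Nat.pow_le_pow_right hU (htl i))).trans_lt hB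
      have hm := hmono i hi
      refine (partialPower_step hE hEU hm (htl _) hBi (ih (Nat.le_of_succ_le hi))).mono
        ?_ ?_ ?_
      · rw [← mul_assoc, ← pow_add, Nat.sub_add_cancel hm]
      · have h1 : V.card ^ t (i + 1) * U.card ^ (l - t (i + 1)) * U.card ^ (t (i + 1) - t i) ≤
            R := by
          refine le_trans (le_of_eq ?_) (hcost i hi)
          rw [mul_assoc, ← pow_add]
          congr 2
          have := htl (i + 1)
          omega
        have h2 : 1 ≤ U.card ^ (t (i + 1) - t i) := Nat.one_le_pow _ _ hU
        generalize U.card ^ (t (i + 1) - t i) = e at h1 h2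
        generalize V.card ^ t (i + 1) * U.card ^ (l - t (i + 1)) = a at h1
        rw [add_mul, one_mul, ← add_assoc]
        refine Nat.add_le_add_left ?_ _
        calc a * 2 * m * (2 * (e * 2 * m) + 1) ≤ a * 2 * m * (2 * (e * 2 * m) + e) := by gcongr
          _ = a * e * (2 * m * (4 * m + 1)) := by ring
          _ ≤ _ := Nat.mul_le_mul_right _ h1
      · omega
  have := key n le_rfl
  rwa [htn] at this

end ThresholdCircuit.ComputesSigned

/-! ### The schedule of the stages -/

/-- If `q < r` then `q ^ (d + 1) ≤ r ^ d` for some `d`. -/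
theorem Nat.exists_pow_succ_le_pow {q r : ℕ} (h : q < r) : ∃ d, 0 < d ∧ q ^ (d + 1) ≤ r ^ d := by
  rcases Nat.eq_zero_or_pos q with rfl | hq
  · exact ⟨1, one_pos, by simp⟩
  -- By Bernoulli's inequality `(1 + 1 / q) ^ (q * q) ≥ 1 + q`, which pays for the additional factor
  -- `q`.
  refine ⟨q * q, Nat.mul_pos hq hq, ?_⟩
  have h2 : ((q : ℝ) + 1) ^ (q * q) ≥ (q : ℝ) ^ (q * q) * q := by
    have hq' : (0 : ℝ) < q := by exact_mod_cast hq
    have hb := one_add_mul_le_pow (a := 1 / (q : ℝ)) (by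
      have : 0 < 1 / (q : ℝ) := by positivity
      linarith) (q * q)
    have h3 : (q : ℝ) ≤ (1 + 1 / (q : ℝ)) ^ (q * q) := by
      refine le_trans ?_ hb
      push_cast
      field_simp
      nlinarith
    calc (q : ℝ) ^ (q * q) * q ≤ (q : ℝ) ^ (q * q) * (1 + 1 / (q : ℝ)) ^ (q * q) := by gcongr
      _ = ((q : ℝ) + 1) ^ (q * q) := by
        rw [← mul_pow]
        congr 1
        field_simp
  have h4 : q ^ (q * q + 1) ≤ (q + 1) ^ (q * q) := by
    rw [pow_succ]
    exact_mod_cast h2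
  exact h4.trans (Nat.pow_le_pow_left h _)

/-- The numbers `l`, `d l / (d + 1)`, …: the number of factors left after each stage. -/
def remaining (d l : ℕ) : ℕ → ℕ
  | 0 => l
  | i + 1 => d * remaining d l i / (d + 1)

theorem remaining_succ_le (d l i : ℕ) : remaining d l (i + 1) ≤ remaining d l i := by
  refine Nat.div_le_of_le_mul ?_
  exact Nat.mul_le_mul_right _ (Nat.le_succ d)

theorem remaining_le (d l i : ℕ) : remaining d l i ≤ l := by
  induction i with
  | zero => exact le_rfl
  | succ i ih => exact (remaining_succ_le d l i).trans ih

/-- Geometric decay with ratio `d / (d + 1)`, with denominators cleared. -/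
theorem remaining_mul_le (d l i : ℕ) : remaining d l i * (d + 1) ^ i ≤ d ^ i * l := by
  induction i with
  | zero => simp [remaining]
  | succ i ih =>
    calc remaining d l (i + 1) * (d + 1) ^ (i + 1)
        = (d * remaining d l i / (d + 1) * (d + 1)) * (d + 1) ^ i := by
          rw [remaining, pow_succ]; ring
      _ ≤ (d * remaining d l i) * (d + 1) ^ i := Nat.mul_le_mul_right _ (Nat.div_mul_le_self _ _)
      _ = d * (remaining d l i * (d + 1) ^ i) := by ring
      _ ≤ d * (d ^ i * l) := Nat.mul_le_mul_left _ ih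
      _ = d ^ (i + 1) * l := by ring

/-- Since `(1 + 1 / d) ^ d ≥ 2`, every `d` stages at least halve the bound, and `Nat.log 2 l + 1`
halvings bring it below `1`. This is where the depth `O(log log N)` comes from. -/
theorem remaining_eq_zero {d : ℕ} (hd : 0 < d) (l : ℕ) :
    remaining d l (d * (Nat.log 2 l + 1)) = 0 := by
  by_contra hne
  have h1 := remaining_mul_le d l (d * (Nat.log 2 l + 1))
  have h2 : 2 * d ^ d ≤ (d + 1) ^ d := by
    have := one_add_mul_le_pow (a := 1 / (d : ℝ)) (by
      have : 0 < 1 / (d : ℝ) := by positivity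
      linarith) d
    have hd' : (0 : ℝ) < d := by exact_mod_cast hd
    have h3 : (2 : ℝ) * d ^ d ≤ (d + 1) ^ d := by
      calc (2 : ℝ) * d ^ d = (1 + d * (1 / (d : ℝ))) * d ^ d := by field_simp; norm_num
        _ ≤ (1 + 1 / (d : ℝ)) ^ d * d ^ d := by gcongr
        _ = ((d : ℝ) + 1) ^ d := by
          rw [← mul_pow]
          congr 1
          field_simp
    exact_mod_cast h3
  have h4 : l < 2 ^ (Nat.log 2 l + 1) := Nat.lt_pow_succ_log_self (by norm_num) l
  have h5 : d ^ (d * (Nat.log 2 l + 1)) * 2 ^ (Nat.log 2 l + 1) ≤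
      (d + 1) ^ (d * (Nat.log 2 l + 1)) := by
    rw [pow_mul, pow_mul, ← mul_pow, mul_comm]
    exact Nat.pow_le_pow_left h2 _
  have h6 : 0 < d ^ (d * (Nat.log 2 l + 1)) := by positivity
  have h7 : (d + 1) ^ (d * (Nat.log 2 l + 1)) ≤ d ^ (d * (Nat.log 2 l + 1)) * l :=
    (Nat.le_mul_of_pos_left _ (Nat.pos_of_ne_zero hne)).trans h1
  have h8 := Nat.le_of_mul_le_mul_left (h5.trans h7) h6
  omega

/-- Compare `(d + 1)`-th powers. The `+ 1` in the exponent makes up for the rounding in `remaining`.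
-/
theorem pow_remaining_le {q r d : ℕ} (h : q ^ (d + 1) ≤ r ^ d) (hr : 0 < r) (l i : ℕ) :
    q ^ remaining d l i ≤ r ^ (remaining d l (i + 1) + 1) := by
  have h1 : d * remaining d l i ≤ (d + 1) * (remaining d l (i + 1) + 1) := by
    rw [remaining]
    exact (Nat.lt_mul_div_succ _ (Nat.succ_pos d)).le
  refine (Nat.pow_le_pow_iff_left (Nat.succ_ne_zero d)).1 ?_
  calc (q ^ remaining d l i) ^ (d + 1) = (q ^ (d + 1)) ^ remaining d l i := by
        rw [← pow_mul, ← pow_mul, mul_comm]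
    _ ≤ (r ^ d) ^ remaining d l i := Nat.pow_le_pow_left h _
    _ = r ^ (d * remaining d l i) := by rw [← pow_mul]
    _ ≤ r ^ ((d + 1) * (remaining d l (i + 1) + 1)) := Nat.pow_le_pow_right hr h1
    _ = (r ^ (remaining d l (i + 1) + 1)) ^ (d + 1) := by rw [← pow_mul, mul_comm]

/-- The left side is the cost `r ^ h' * q ^ (l - h)` of the stage from `h` to `h'`; every stage
exceeds `r ^ l` by at most a factor `r`. -/
theorem pow_mul_pow_remaining_le {q r d : ℕ} (h : q ^ (d + 1) ≤ r ^ d) (hr : 0 < r) (l i : ℕ) :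
    r ^ (l - remaining d l (i + 1)) * q ^ remaining d l i ≤ r ^ (l + 1) := by
  have := remaining_le d l (i + 1)
  calc r ^ (l - remaining d l (i + 1)) * q ^ remaining d l i
      ≤ r ^ (l - remaining d l (i + 1)) * r ^ (remaining d l (i + 1) + 1) :=
        Nat.mul_le_mul_left _ (pow_remaining_le h hr l i)
    _ = r ^ (l + 1) := by
        rw [← pow_add]
        congr 1
        omega

/-! ### Kronecker powers of the multiplication algorithm -/

namespace FastMatMul

variable {T r : ℕ} (alg : FastMatMul T r)

/-- Evaluating `correct` at matrix units gives Brent's equations. Being identities between the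
weights alone, they can be multiplied over the tensor coordinates. -/
theorem sum_weights (i j p q p' q' : Fin T) :
    ∑ m, alg.wC i j m * (alg.wA m p q * alg.wB m p' q') =
      if i = p ∧ q = p' ∧ q' = j then 1 else 0 := by
  have h := alg.correct (Matrix.single p q 1) (Matrix.single p' q' 1) i j
  have hs : ∀ (w : Fin T → Fin T → ℤ) (p q : Fin T),
      ∑ a, ∑ b, w a b * Matrix.single p q (1 : ℤ) a b = w p q := by
    intro w p q
    rw [Finset.sum_eq_single p, Finset.sum_eq_single q]
    · simp
    · intro b _ hb
      simp [Matrix.single_apply_of_col_ne _ _ hb.symm]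
    · simp
    · intro a _ ha
      simp [Matrix.single_apply_of_row_ne ha.symm]
    · simp
  simp only [hs] at h
  rw [← h]
  by_cases hq : q = p'
  · subst hq
    rw [Matrix.single_mul_single_same, Matrix.single_apply]
    simp [eq_comm]
  · rw [Matrix.single_mul_single_of_ne _ _ _ _ hq]
    simp [hq]

/-- The Kronecker powers of the algorithm multiply matrices that are indexed by tuples. -/
theorem correct_pow {l : ℕ} (A B : (Fin l → Fin T) → (Fin l → Fin T) → ℤ)
    (i j : Fin l → Fin T) :
    ∑ μ : Fin l → Fin r, (∏ k, alg.wC (i k) (j k) (μ k)) *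
      ((∑ a : Fin l → Fin T × Fin T, (∏ k, alg.wA (μ k) (a k).1 (a k).2) *
          A (fun k => (a k).1) (fun k => (a k).2)) *
        (∑ a : Fin l → Fin T × Fin T, (∏ k, alg.wB (μ k) (a k).1 (a k).2) *
          B (fun k => (a k).1) (fun k => (a k).2))) =
      ∑ q, A i q * B q j := by
  have h1 : ∀ a b : Fin l → Fin T × Fin T,
      ∑ μ : Fin l → Fin r, (∏ k, alg.wC (i k) (j k) (μ k)) *
        ((∏ k, alg.wA (μ k) (a k).1 (a k).2) * (∏ k, alg.wB (μ k) (b k).1 (b k).2)) =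
      if (i = fun k => (a k).1) ∧ ((fun k => (a k).2) = fun k => (b k).1) ∧
        ((fun k => (b k).2) = j) then 1 else 0 := by
    intro a b
    -- The product over `k` of Brent's equations, expanded by distributivity, becomes a sum over
    -- tuples `μ`.
    have h := Finset.prod_univ_sum (fun _ : Fin l => (Finset.univ : Finset (Fin r)))
      (fun k μ => alg.wC (i k) (j k) μ *
        (alg.wA μ (a k).1 (a k).2 * alg.wB μ (b k).1 (b k).2))
    rw [Fintype.piFinset_univ] at h
    simp only [Finset.prod_mul_distrib, sum_weights] at h
    rw [← h, Finset.prod_ite_zero]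
    simp [funext_iff, forall_and]
  calc _ = ∑ a : Fin l → Fin T × Fin T, ∑ b : Fin l → Fin T × Fin T,
        (∑ μ : Fin l → Fin r, (∏ k, alg.wC (i k) (j k) (μ k)) *
        ((∏ k, alg.wA (μ k) (a k).1 (a k).2) * (∏ k, alg.wB (μ k) (b k).1 (b k).2))) *
        (A (fun k => (a k).1) (fun k => (a k).2) * B (fun k => (b k).1) (fun k => (b k).2)) := by
        simp only [Finset.mul_sum, Finset.sum_mul]
        conv_rhs => rw [Finset.sum_comm]
        rw [Finset.sum_comm]
        refine Finset.sum_congr rfl fun a _ => ?_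
        rw [Finset.sum_comm]
        refine Finset.sum_congr rfl fun b _ => Finset.sum_congr rfl fun μ _ => ?_
        ring
    _ = ∑ p : (Fin l → Fin T) × (Fin l → Fin T), ∑ p' : (Fin l → Fin T) × (Fin l → Fin T),
        (if i = p.1 ∧ p.2 = p'.1 ∧ p'.2 = j then 1 else 0) * (A p.1 p.2 * B p'.1 p'.2) := by
        simp only [h1]
        rw [← (Equiv.arrowProdEquivProdArrow (Fin l) (fun _ => Fin T) (fun _ => Fin T)).sum_comp]
        refine Finset.sum_congr rfl fun a _ => ?_
        rw [← (Equiv.arrowProdEquivProdArrow (Fin l) (fun _ => Fin T) (fun _ => Fin T)).sum_comp]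
        rfl
    _ = ∑ q, A i q * B q j := by
        simp only [Fintype.sum_prod_type, ite_and, ite_mul, one_mul, zero_mul]
        simp

end FastMatMul

/-- The integer matrix that is represented by bits. -/
def bitMatrix {N b : ℕ} (x : MatrixBits N b → Bool) : Matrix (Fin N) (Fin N) ℤ := fun i j =>
  binaryValue (fun t => x (i, j, true, t)) - binaryValue (fun t => x (i, j, false, t))

theorem Represents.eq_bitMatrix {N b : ℕ} {x : MatrixBits N b → Bool}
    {A : Matrix (Fin N) (Fin N) ℤ} (h : Represents x A) : A = bitMatrix x := by
  ext i j
  exact h i j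

theorem binaryValue_testBit {m n : ℕ} (h : n < 2 ^ m) :
    binaryValue (fun t : Fin m => n.testBit t) = n := by
  conv_rhs => rw [← Nat.sum_testBit_mul_two_pow h]
  rw [binaryValue, Nat.cast_sum]
  refine Finset.sum_congr rfl fun t _ => ?_
  rw [Nat.cast_mul, Bool.natCast_toNat_eq_toInt]
  push_cast
  rfl

/-! ### The two schedules: expansion into forms and contraction of products -/

namespace ThresholdCircuit.ComputesSigned

variable {ι X Y : Type} [Fintype ι] {m B s d : ℕ}

theorem comp {V : (ι → Bool) → X → ℤ} (hV : ComputesSigned m V B s d) (φ : Y → X) :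
    ComputesSigned m (fun x y => V x (φ y)) B s d := by
  obtain ⟨u, hu, hVu, hR⟩ := hV
  exact ⟨fun x p => u x (φ p.1, p.2), fun x p => hu x _, fun x y => hVu x _,
    hR.comp_output fun p : (Y × Bool) × Fin m => ((φ p.1.1, p.1.2), p.2)⟩

theorem exists_represents {V : (ι → Bool) → X → ℤ} (hV : ComputesSigned m V B s d)
    (hB : B < 2 ^ m) {N : ℕ} (φ : Fin N → Fin N → X) :
    ∃ C : ThresholdCircuit ι (MatrixBits N m),
      (∀ x, Represents (C.compute x) (fun i j => V x (φ i j))) ∧ C.size ≤ s ∧ C.depth ≤ d := by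
  obtain ⟨u, hu, hVu, hR⟩ := hV
  obtain ⟨C, hC, hs, hd⟩ := hR.comp_output
    (fun p : MatrixBits N m => ((φ p.1 p.2.1, p.2.2.1), p.2.2.2))
  refine ⟨C, fun x i j => ?_, hs, Finset.sup_le fun k _ => hd k⟩
  rw [hC]
  exact (hVu x _).trans (congrArg₂ _ (binaryValue_testBit ((hu x _).trans_lt hB)).symm
    (binaryValue_testBit ((hu x _).trans_lt hB)).symm)

variable {K : Type} [Fintype K] [DecidableEq K] {l : ℕ}
  {E : Matrix K K ℤ} {U V : Finset K} {F : (ι → Bool) → (Fin l → K) → ℤ} {q r e : ℕ}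

/-- Indices pass from the small set to the large one, so the numbers multiply as the stages proceed;
the early stages treat long blocks and the late ones short blocks. -/
theorem partialPower_expand (hq : 0 < q) (he : 0 < e) (hr : 0 < r)
    (hqr : q ^ (e + 1) ≤ r ^ e) (hUc : U.card = q) (hVc : V.card = r)
    (hE : ∀ a b, |E a b| ≤ 1) (hEU : ∀ a b, E a b ≠ 0 → b ∈ U) (hB : q ^ l * B < 2 ^ m)
    (hF : ComputesSigned m (fun x (c : mixedIndices l U V 0) => F x c) B s d) :
    ComputesSigned m
      (fun x (c : mixedIndices l U V l) => (partialPower l E l).mulVec (F x) c) (q ^ l * B)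
      (s + (e * (Nat.log 2 l + 1)) * (r ^ (l + 1) * (2 * m * (4 * m + 1))))
      (d + 2 * (e * (Nat.log 2 l + 1))) := by
  subst hUc hVc
  refine partialPower_of_schedule hE hEU hq hB hF (fun i => l - remaining e l i) _ _ ?_ ?_ ?_ ?_ ?_
  · simp [remaining]
  · simp [remaining_eq_zero he]
  · intro i _
    exact Nat.sub_le_sub_left (remaining_succ_le e l i) l
  · intro i
    exact Nat.sub_le _ _
  · intro i _
    rw [Nat.sub_sub_self (remaining_le e l i)]
    exact pow_mul_pow_remaining_le hqr hr l i

/-- The roles of `q` and `r` are exchanged, so a stage costs `q ^ h' * r ^ (l - h)`. With the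
schedule reversed, `h` and `h'` are consecutive values of `remaining`, and the same inequality
bounds the cost. -/
theorem partialPower_contract (he : 0 < e) (hr : 0 < r)
    (hqr : q ^ (e + 1) ≤ r ^ e) (hUc : U.card = r) (hVc : V.card = q)
    (hE : ∀ a b, |E a b| ≤ 1) (hEU : ∀ a b, E a b ≠ 0 → b ∈ U) (hB : r ^ l * B < 2 ^ m)
    (hF : ComputesSigned m (fun x (c : mixedIndices l U V 0) => F x c) B s d) :
    ComputesSigned m
      (fun x (c : mixedIndices l U V l) => (partialPower l E l).mulVec (F x) c) (r ^ l * B)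
      (s + (e * (Nat.log 2 l + 1)) * (r ^ (l + 1) * (2 * m * (4 * m + 1))))
      (d + 2 * (e * (Nat.log 2 l + 1))) := by
  subst hUc hVc
  refine partialPower_of_schedule hE hEU hr hB hF
    (fun i => remaining e l (e * (Nat.log 2 l + 1) - i)) _ _ ?_ ?_ ?_ ?_ ?_
  · simp [remaining_eq_zero he]
  · simp [remaining]
  · intro i hi
    obtain ⟨j, hj⟩ := Nat.exists_eq_add_of_lt hi
    have h1 : e * (Nat.log 2 l + 1) - i = j + 1 := by omega
    have h2 : e * (Nat.log 2 l + 1) - (i + 1) = j := by omega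
    rw [h1, h2]
    exact remaining_succ_le e l j
  · intro i
    exact remaining_le _ _ _
  · intro i hi
    obtain ⟨j, hj⟩ := Nat.exists_eq_add_of_lt hi
    have h1 : e * (Nat.log 2 l + 1) - i = j + 1 := by omega
    have h2 : e * (Nat.log 2 l + 1) - (i + 1) = j := by omega
    rw [h1, h2, mul_comm]
    exact pow_mul_pow_remaining_le hqr hr l j

end ThresholdCircuit.ComputesSigned

/-- Tuples with a component outside the range of `g` have weight zero. This removes the unused
labels and leads back to the sums of `correct_pow`. -/
theorem partialPower_self_mulVec {K J : Type} [Fintype K] [DecidableEq K] [Fintype J] {l : ℕ}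
    {E : Matrix K K ℤ} {g : J → K} (hg : Function.Injective g)
    (hE : ∀ a b, E a b ≠ 0 → b ∈ Set.range g) (F : (Fin l → K) → ℤ) (c : Fin l → K) :
    (partialPower l E l).mulVec F c =
      ∑ a : Fin l → J, (∏ k, E (c k) (g (a k))) * F (fun k => g (a k)) := by
  symm
  refine Finset.sum_of_injOn (fun a k => g (a k)) ?_ (fun _ _ => Finset.mem_univ _) ?_ ?_
  · exact (hg.comp_left).injOn
  · intro x _ hx
    have hx' : partialPower l E l c x = 0 := by
      by_contra h0
      simp only [partialPower, piKronecker, Matrix.of_apply, Fin.is_lt, if_true] at h0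
      have h1 : ∀ k, ∃ j, g j = x k := fun k =>
        hE _ _ (Finset.prod_ne_zero_iff.1 h0 k (Finset.mem_univ k))
      choose a ha using h1
      exact hx ⟨a, by simp, funext ha⟩
    change partialPower l E l c x * F x = 0
    rw [hx', zero_mul]
  · intro a _
    simp [partialPower, piKronecker]

/-! ### The circuit for a given algorithm -/

namespace FastMatMul

open ThresholdCircuit

variable {T r : ℕ}

/-- The labels of the multiplications and the positions of the entries of a `T × T` matrix. -/
abbrev Label (T r : ℕ) : Type := Fin r ⊕ (Fin T × Fin T)

/-- The labels of the multiplications. -/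
def multLabels (T r : ℕ) : Finset (Label T r) := Finset.univ.map Function.Embedding.inl

/-- The labels of the entries. -/
def entryLabels (T r : ℕ) : Finset (Label T r) := Finset.univ.map Function.Embedding.inr

theorem card_multLabels : (multLabels T r).card = r := by simp [multLabels]

theorem card_entryLabels : (entryLabels T r).card = T ^ 2 := by simp [entryLabels, sq]

/-- The matrix of the linear forms whose products are taken. -/
def formMatrix (w : Fin r → Fin T → Fin T → ℤ) : Matrix (Label T r) (Label T r) ℤ :=
  Matrix.of fun a b => Sum.elim (fun μ => Sum.elim (fun _ => 0) (fun p => w μ p.1 p.2) b)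
    (fun _ => 0) a

/-- The matrix that recombines the products. -/
def recombinationMatrix (w : Fin T → Fin T → Fin r → ℤ) : Matrix (Label T r) (Label T r) ℤ :=
  Matrix.of fun a b => Sum.elim (fun _ => 0)
    (fun p => Sum.elim (fun μ => w p.1 p.2 μ) (fun _ => 0) b) a

theorem abs_formMatrix_le {w : Fin r → Fin T → Fin T → ℤ}
    (hw : ∀ m p q, w m p q = -1 ∨ w m p q = 0 ∨ w m p q = 1) (a b : Label T r) :
    |formMatrix w a b| ≤ 1 := by
  rcases a with μ | p <;> rcases b with μ' | p' <;> simp [formMatrix]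
  rcases hw μ p'.1 p'.2 with h | h | h <;> simp [h]

theorem abs_recombinationMatrix_le {w : Fin T → Fin T → Fin r → ℤ}
    (hw : ∀ i j m, w i j m = -1 ∨ w i j m = 0 ∨ w i j m = 1) (a b : Label T r) :
    |recombinationMatrix w a b| ≤ 1 := by
  rcases a with μ | p <;> rcases b with μ' | p' <;> simp [recombinationMatrix]
  rcases hw p.1 p.2 μ' with h | h | h <;> simp [h]

theorem exists_of_formMatrix_ne_zero {w : Fin r → Fin T → Fin T → ℤ} (a b : Label T r)
    (h : formMatrix w a b ≠ 0) : b ∈ Set.range (Sum.inr : _ → Label T r) := by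
  rcases a with μ | p <;> rcases b with μ' | p' <;> simp [formMatrix] at h ⊢

theorem exists_of_recombinationMatrix_ne_zero {w : Fin T → Fin T → Fin r → ℤ} (a b : Label T r)
    (h : recombinationMatrix w a b ≠ 0) : b ∈ Set.range (Sum.inl : _ → Label T r) := by
  rcases a with μ | p <;> rcases b with μ' | p' <;> simp [recombinationMatrix] at h ⊢

/-- The entry of a `T ^ l × T ^ l` matrix at the position given by the labels `c`; labels of
multiplications are ignored. -/
def entryAt [NeZero T] {l : ℕ} (A : Matrix (Fin (T ^ l)) (Fin (T ^ l)) ℤ)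
    (c : Fin l → Label T r) : ℤ :=
  A (finFunctionFinEquiv fun k => (Sum.elim (fun _ => 0) Prod.fst (c k) : Fin T))
    (finFunctionFinEquiv fun k => (Sum.elim (fun _ => 0) Prod.snd (c k) : Fin T))

/-- The values of the linear forms of the `l`-th Kronecker power of the algorithm. -/
def formValue [NeZero T] {l : ℕ} (w : Fin r → Fin T → Fin T → ℤ)
    (A : Matrix (Fin (T ^ l)) (Fin (T ^ l)) ℤ) (c : Fin l → Label T r) : ℤ :=
  (partialPower l (formMatrix w) l).mulVec (entryAt A) c

/-- This is `correct_pow`, with `finFunctionFinEquiv` identifying a row or column number below `T ^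
l` with its `l` digits in base `T`. -/
theorem recombination_eq_mul [NeZero T] (alg : FastMatMul T r) {l : ℕ}
    (A B : Matrix (Fin (T ^ l)) (Fin (T ^ l)) ℤ) (i j : Fin (T ^ l)) :
    (partialPower l (recombinationMatrix alg.wC) l).mulVec
      (fun c => formValue alg.wA A c * formValue alg.wB B c)
      (fun k => Sum.inr (finFunctionFinEquiv.symm i k, finFunctionFinEquiv.symm j k)) =
      (A * B) i j := by
  have h := alg.correct_pow
    (fun i j => A (finFunctionFinEquiv i) (finFunctionFinEquiv j))
    (fun i j => B (finFunctionFinEquiv i) (finFunctionFinEquiv j))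
    (finFunctionFinEquiv.symm i) (finFunctionFinEquiv.symm j)
  rw [partialPower_self_mulVec Sum.inl_injective exists_of_recombinationMatrix_ne_zero]
  simp only [formValue, partialPower_self_mulVec Sum.inr_injective exists_of_formMatrix_ne_zero]
  refine Eq.trans ?_ (h.trans ?_)
  · rfl
  · simp only [Equiv.apply_symm_apply]
    rw [Matrix.mul_apply, ← finFunctionFinEquiv.sum_comp]

variable {ι : Type} [Fintype ι] {l b m e : ℕ}

theorem computesSigned_formValue [NeZero T] (hT : 0 < T ^ 2) (hr : 0 < r) (he : 0 < e)
    (hqr : (T ^ 2) ^ (e + 1) ≤ r ^ e) {w : Fin r → Fin T → Fin T → ℤ}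
    (hw : ∀ m p q, w m p q = -1 ∨ w m p q = 0 ∨ w m p q = 1)
    (hB : (T ^ 2) ^ l * 2 ^ b < 2 ^ m) (φ : MatrixBits (T ^ l) b → ι) :
    ComputesSigned m
      (fun x (c : mixedIndices l (entryLabels T r) (multLabels T r) l) =>
        formValue w (bitMatrix fun p => x (φ p)) c) ((T ^ 2) ^ l * 2 ^ b)
      ((T ^ 2) ^ l * 2 * m * (2 * b + 1) +
        (e * (Nat.log 2 l + 1)) * (r ^ (l + 1) * (2 * m * (4 * m + 1))))
      (2 + 2 * (e * (Nat.log 2 l + 1))) := by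
  have h0 := ComputesSigned.input m
    (fun p : (mixedIndices l (entryLabels T r) (multLabels T r) 0 × Bool) × Fin b =>
      φ (finFunctionFinEquiv fun k => (Sum.elim (fun _ => 0) Prod.fst (p.1.1.1 k) : Fin T),
        finFunctionFinEquiv fun k => (Sum.elim (fun _ => 0) Prod.snd (p.1.1.1 k) : Fin T),
        p.1.2, p.2))
  rw [Fintype.card_coe, card_mixedIndices _ _ (Nat.zero_le l), card_entryLabels, pow_zero,
    one_mul, Nat.sub_zero] at h0
  exact ComputesSigned.partialPower_expand
    (F := fun x => entryAt (bitMatrix fun p => x (φ p))) hT he hr hqr card_entryLabels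
    card_multLabels (abs_formMatrix_le hw)
    (fun a b hab => by simpa [entryLabels] using exists_of_formMatrix_ne_zero a b hab) hB h0

theorem exists_circuit (alg : FastMatMul T r) (hT : 0 < T) (hr : 0 < r) (he : 0 < e)
    (hqr : (T ^ 2) ^ (e + 1) ≤ r ^ e) (hB : (T ^ 2) ^ l * 2 ^ b < 2 ^ m)
    (hB' : r ^ l * (2 * ((T ^ 2) ^ l * 2 ^ b * ((T ^ 2) ^ l * 2 ^ b))) < 2 ^ m) :
    ∃ C : ThresholdCircuit (MatrixBits (T ^ l) b ⊕ MatrixBits (T ^ l) b) (MatrixBits (T ^ l) m),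
      ComputesMatrixProduct C ∧
      C.size ≤ 2 * ((T ^ 2) ^ l * 2 * m * (2 * b + 1)) +
        3 * ((e * (Nat.log 2 l + 1)) * (r ^ (l + 1) * (2 * m * (4 * m + 1)))) +
        r ^ l * ((2 * m) ^ 2 + 2 * m * (2 * (2 * m) ^ 2 + 1)) ∧
      C.depth ≤ 5 + 4 * (e * (Nat.log 2 l + 1)) := by
  have : NeZero T := ⟨hT.ne'⟩
  have hA := computesSigned_formValue (by positivity) hr he hqr alg.wA_mem hB
    (Sum.inl : _ → MatrixBits (T ^ l) b ⊕ MatrixBits (T ^ l) b)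
  have hBB := computesSigned_formValue (by positivity) hr he hqr alg.wB_mem hB
    (Sum.inr : _ → MatrixBits (T ^ l) b ⊕ MatrixBits (T ^ l) b)
  -- The end of the expansion is the start of the contraction: in both, all components are labels of
  -- multiplications.
  have hP := (hA.mul hB hBB hB).comp
    (fun c : mixedIndices l (multLabels T r) (entryLabels T r) 0 =>
      (⟨c.1, by simpa [mixedIndices] using c.2⟩ :
        mixedIndices l (entryLabels T r) (multLabels T r) l))
  have hC := ComputesSigned.partialPower_contract (E := recombinationMatrix alg.wC)
    (F := fun x c => formValue alg.wA (bitMatrix fun p => x (Sum.inl p)) c *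
      formValue alg.wB (bitMatrix fun p => x (Sum.inr p)) c)
    he hr hqr card_multLabels card_entryLabels
    (abs_recombinationMatrix_le alg.wC_mem)
    (fun a b hab => by
      simpa [multLabels] using exists_of_recombinationMatrix_ne_zero a b hab) hB' hP
  obtain ⟨C, hC, hs, hd⟩ := hC.exists_represents hB' (N := T ^ l) (fun i j =>
    ⟨fun k => Sum.inr (finFunctionFinEquiv.symm i k, finFunctionFinEquiv.symm j k), by
      simp [mixedIndices, entryLabels]⟩)
  refine ⟨C, fun A B x y hx hy => ?_, hs.trans (le_of_eq ?_), hd.trans (le_of_eq ?_)⟩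
  · intro i j
    rw [← hC (Sum.elim x y) i j, hx.eq_bitMatrix, hy.eq_bitMatrix]
    exact (alg.recombination_eq_mul (bitMatrix x) (bitMatrix y) i j).symm
  · rw [Fintype.card_coe, card_mixedIndices _ _ le_rfl, card_multLabels, Nat.sub_self, pow_zero,
      mul_one]
    ring
  · ring

theorem exists_circuit_le (alg : FastMatMul T r) (hT : 2 ≤ T) (hr : T ^ 2 < r) :
    ∃ e : ℕ, ∀ l b : ℕ, ∃ C : ThresholdCircuit
        (MatrixBits (T ^ l) b ⊕ MatrixBits (T ^ l) b) (MatrixBits (T ^ l) (3 * r * l + 2 * b + 2)),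
      ComputesMatrixProduct C ∧
      C.size ≤ e * (r ^ l * (3 * r * l + 2 * b + 2) ^ 3) ∧
      C.depth ≤ e * (Nat.log 2 l + 1) := by
  obtain ⟨e, he, hqr⟩ := Nat.exists_pow_succ_le_pow hr
  have hr0 : 0 < r := (Nat.zero_le _).trans_lt hr
  -- The three terms of the size contribute `12`, `30 * e * r` and `22`; the depth needs `5` and `4
  -- * e`.
  refine ⟨34 + 30 * e * r + 4 * e, fun l b => ?_⟩
  have hrl : r ^ l ≤ 2 ^ (r * l) := by
    rw [pow_mul]
    exact Nat.pow_le_pow_left Nat.lt_two_pow_self.le l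
  have hql : (T ^ 2) ^ l ≤ r ^ l := Nat.pow_le_pow_left hr.le l
  have hq2 : (T ^ 2) ^ l * 2 ^ b ≤ 2 ^ (r * l + b) := by
    rw [pow_add]
    exact Nat.mul_le_mul_right _ (hql.trans hrl)
  -- Each linear form is bounded by `2 ^ (r * l + b)`; multiplying two of them and recombining gives
  -- at most `2 ^ (3 * r * l + 2 * b + 1)`, so `m` bits hold every intermediate number.
  obtain ⟨C, hC, hs, hd⟩ := alg.exists_circuit (l := l) (b := b) (m := 3 * r * l + 2 * b + 2)
    (by omega) hr0 he hqr
    (hq2.trans_lt (Nat.pow_lt_pow_right (by norm_num) (by nlinarith [Nat.zero_le (r * l)])))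
    (by
      calc r ^ l * (2 * ((T ^ 2) ^ l * 2 ^ b * ((T ^ 2) ^ l * 2 ^ b)))
          ≤ 2 ^ (r * l) * (2 * (2 ^ (r * l + b) * 2 ^ (r * l + b))) := by gcongr
        _ = 2 ^ (3 * r * l + 2 * b + 1) := by ring
        _ < _ := Nat.pow_lt_pow_right (by norm_num) (by omega))
  refine ⟨C, hC, hs.trans ?_, hd.trans ?_⟩
  · have hbm : b ≤ 3 * r * l + 2 * b + 2 := by omega
    have hlm : l + 1 ≤ 3 * r * l + 2 * b + 2 := by nlinarith [Nat.mul_le_mul_right l hr0]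
    generalize 3 * r * l + 2 * b + 2 = m at hbm hlm
    have hm : 1 ≤ m := by omega
    have hn : Nat.log 2 l + 1 ≤ m :=
      (Nat.add_le_add_right (Nat.log_le_self 2 l) 1).trans hlm
    have hm2 : m ^ 2 ≤ m ^ 3 := Nat.pow_le_pow_right hm (by norm_num)
    have hm1 : m ≤ m ^ 2 := by nlinarith
    have h1 : 2 * ((T ^ 2) ^ l * 2 * m * (2 * b + 1)) ≤ r ^ l * (12 * m ^ 3) := by
      calc 2 * ((T ^ 2) ^ l * 2 * m * (2 * b + 1)) ≤ 2 * (r ^ l * 2 * m * (2 * m + m)) := by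
            gcongr
        _ = r ^ l * (12 * m ^ 2) := by ring
        _ ≤ _ := by gcongr
    have h2 : 3 * ((e * (Nat.log 2 l + 1)) * (r ^ (l + 1) * (2 * m * (4 * m + 1)))) ≤
        r ^ l * (30 * e * r * m ^ 3) := by
      calc _ ≤ 3 * ((e * m) * (r ^ (l + 1) * (2 * m * (4 * m + m)))) := by gcongr
        _ = _ := by ring
    have h3 : r ^ l * ((2 * m) ^ 2 + 2 * m * (2 * (2 * m) ^ 2 + 1)) ≤ r ^ l * (22 * m ^ 3) := by
      refine Nat.mul_le_mul_left _ ?_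
      nlinarith
    calc _ ≤ r ^ l * (12 * m ^ 3) + r ^ l * (30 * e * r * m ^ 3) + r ^ l * (22 * m ^ 3) :=
          Nat.add_le_add (Nat.add_le_add h1 h2) h3
      _ = (34 + 30 * e * r) * (r ^ l * m ^ 3) := by ring
      _ ≤ _ := Nat.mul_le_mul_right _ (by omega)
  · nlinarith [Nat.zero_le (Nat.log 2 l), Nat.zero_le (e * r),
      Nat.zero_le (e * r * Nat.log 2 l)]

end FastMatMul

/-! ### Asymptotics in terms of `N = T ^ l` -/

/-- For `l > 0` the right side is `log l + log (log T)`. The constant, negative for `T = 2`, is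
absorbed because the right side tends to infinity. -/
theorem natLog_isBigO_log_log_pow {T : ℕ} (hT : 2 ≤ T) :
    (fun l : ℕ => ((Nat.log 2 l + 1 : ℕ) : ℝ)) =O[atTop]
      fun l : ℕ => Real.log (Real.log ((T : ℝ) ^ l)) := by
  have hlogT : 0 < Real.log T := Real.log_pos (by exact_mod_cast hT)
  have htend : Tendsto (fun l : ℕ => Real.log (Real.log ((T : ℝ) ^ l))) atTop atTop := by
    refine Real.tendsto_log_atTop.comp ?_
    simp only [Real.log_pow]
    exact tendsto_natCast_atTop_atTop.atTop_mul_const hlogT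
  have hconst : ∀ c : ℝ, (fun _ : ℕ => c) =O[atTop]
      fun l : ℕ => Real.log (Real.log ((T : ℝ) ^ l)) := fun c =>
    (isLittleO_const_left.2 (Or.inr (tendsto_norm_atTop_atTop.comp htend))).isBigO
  have hlog : (fun l : ℕ => Real.log l / Real.log 2) =O[atTop]
      fun l : ℕ => Real.log (Real.log ((T : ℝ) ^ l)) := by
    have h1 : (fun l : ℕ => Real.log (Real.log ((T : ℝ) ^ l)) - Real.log (Real.log T)) =O[atTop]
        fun l : ℕ => Real.log (Real.log ((T : ℝ) ^ l)) := (isBigO_refl _ _).sub (hconst _)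
    refine (h1.const_mul_left (Real.log 2)⁻¹).congr' ?_ EventuallyEq.rfl
    filter_upwards [eventually_gt_atTop 0] with l hl
    have hl' : (l : ℝ) ≠ 0 := by exact_mod_cast hl.ne'
    rw [Real.log_pow, Real.log_mul hl' hlogT.ne']
    ring
  have hle : (fun l : ℕ => ((Nat.log 2 l : ℕ) : ℝ)) =O[atTop]
      fun l : ℕ => Real.log l / Real.log 2 := by
    refine IsBigO.of_bound 1 (Eventually.of_forall fun l => ?_)
    have h := Real.natLog_le_logb l 2
    rw [Real.logb] at h
    rw [one_mul, Real.norm_of_nonneg (Nat.cast_nonneg _)]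
    exact (by exact_mod_cast h : ((Nat.log 2 l : ℕ) : ℝ) ≤ _).trans (le_abs_self _)
  simpa using (hle.trans hlog).add (hconst 1)

theorem mainTheorem2 (T r : ℕ) (hT : 2 ≤ T) (hr : T ^ 2 < r) (alg : FastMatMul T r)
    (b : ℕ → ℕ)
    (hb : (fun l : ℕ => (b l : ℝ)) =O[atTop] fun l : ℕ => Real.log ((T : ℝ) ^ l)) :
    ∃ (m : ℕ → ℕ)
      (C : ∀ l : ℕ, ThresholdCircuit
        (MatrixBits (T ^ l) (b l) ⊕ MatrixBits (T ^ l) (b l)) (MatrixBits (T ^ l) (m l))),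
      (∀ l, ComputesMatrixProduct (C l)) ∧
      ((fun l : ℕ => (m l : ℝ)) =O[atTop] fun l : ℕ => Real.log ((T : ℝ) ^ l)) ∧
      ((fun l : ℕ => ((C l).depth : ℝ)) =O[atTop]
        fun l : ℕ => Real.log (Real.log ((T : ℝ) ^ l))) ∧
      ∃ k : ℕ, (fun l : ℕ => ((C l).size : ℝ)) =O[atTop]
        fun l : ℕ => ((T : ℝ) ^ l) ^ Real.logb T r * Real.log ((T : ℝ) ^ l) ^ k := by
  obtain ⟨e, he⟩ := alg.exists_circuit_le hT hr
  choose C hC hs hd using fun l => he l (b l)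
  have hT1 : (1 : ℝ) < T := by exact_mod_cast hT
  have hlogT : 0 < Real.log T := Real.log_pos hT1
  have hl : (fun l : ℕ => (l : ℝ)) =O[atTop] fun l : ℕ => Real.log ((T : ℝ) ^ l) := by
    refine IsBigO.of_bound (Real.log T)⁻¹ (Eventually.of_forall fun l => ?_)
    rw [Real.log_pow, norm_mul, Real.norm_of_nonneg hlogT.le]
    field_simp
    exact le_rfl
  have h1 : (fun _ : ℕ => (2 : ℝ)) =O[atTop] fun l : ℕ => Real.log ((T : ℝ) ^ l) := by
    refine IsBigO.trans ?_ hl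
    exact (isLittleO_const_left.2
      (Or.inr (tendsto_norm_atTop_atTop.comp tendsto_natCast_atTop_atTop))).isBigO
  have hm : (fun l : ℕ => ((3 * r * l + 2 * b l + 2 : ℕ) : ℝ)) =O[atTop]
      fun l : ℕ => Real.log ((T : ℝ) ^ l) := by
    push_cast
    exact ((hl.const_mul_left _).add (hb.const_mul_left _)).add h1
  refine ⟨_, C, hC, hm, ?_, 3, ?_⟩
  · refine IsBigO.trans ?_ (natLog_isBigO_log_log_pow hT)
    refine IsBigO.of_bound e (Eventually.of_forall fun l => ?_)
    rw [Real.norm_of_nonneg (Nat.cast_nonneg _), Real.norm_of_nonneg (Nat.cast_nonneg _)]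
    exact_mod_cast hd l
  -- `N ^ ω` is `r ^ l`. The exponent `3` of the logarithm is that of `m` in `exists_circuit_le`.
  · have hpow : ∀ l : ℕ, ((T : ℝ) ^ l) ^ Real.logb T r = (r : ℝ) ^ l := by
      intro l
      have hr0 : (0 : ℝ) < r := by exact_mod_cast (Nat.zero_le _).trans_lt hr
      rw [← Real.rpow_natCast, ← Real.rpow_mul (by positivity), mul_comm, Real.rpow_mul
        (by positivity), Real.rpow_logb (by positivity) hT1.ne' hr0, Real.rpow_natCast]
    simp only [hpow]
    refine IsBigO.trans ?_ ((isBigO_refl (fun l : ℕ => (r : ℝ) ^ l) atTop).mul (hm.pow 3))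
    refine IsBigO.of_bound e (Eventually.of_forall fun l => ?_)
    rw [Real.norm_of_nonneg (Nat.cast_nonneg _), Real.norm_of_nonneg (by positivity)]
    exact_mod_cast hs l
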